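/- Let $K=\mathbb{Q}(\sqrt5)$ with algebraic conjugation ${}'$ ($\sqrt5\mapsto-\sqrt5$), let $\tau=(1+\sqrt5)/2$ and $\mathfrak{o}=\mathbb{Z}[\tau]$. In the quaternion algebra $\mathbb{H}(K)\subset\mathbb{H}(\mathbb{R})=\mathbb{R}^4$ write $q=(a,b,c,d)=a+\mathbf{i}b+\mathbf{j}c+\mathbf{k}d$, let $|q|$ be the Euclidean length, so that $|q|^2=q\bar q\in K$, and let $\widetilde q=(a',b',d',c')$ be the twist of $q$. Let $\mathbb{I}$ be the icosian ring, i.e. the set of all $\mathfrak{o}$-linear combinations of $(1,0,0,0)$, $(0,1,0,0)$, $\tfrac12(1,1,1,1)$, $\tfrac12(1-\tau,\tau,0,1)$, and let $$L=\bigl\langle(1,0,0,0),\ \tfrac12(-1,1,1,1),\ (0,-1,0,0),\ \tfrac12(0,1,\tau-1,-\tau)\bigr\rangle_{\mathbb{Z}},$$ a copy of the root lattice $A_4$ rescaled by $1/\sqrt2$. An icosian $p\in\mathbb{I}$ is called primitive if $\alpha p\in\mathbb{I}$ with $\alpha\in K$ implies $\alpha\in\mathfrak{o}$, and admissible if $|p\widetilde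 p|\in\mathbb{N}$. For $a,b\in\mathbb{I}$, $\operatorname{glcd}(a,b)$ denotes a greatest left common divisor of $a$ and $b$ in $\mathbb{I}$, which is determined up to right multiplication by a unit of $\mathbb{I}$. Let $p_1,p_2\in\mathbb{I}$ be primitive and admissible. Then $$L\cap\tfrac{1}{|p_1\widetilde p_1|}\,p_1L\widetilde p_1 \;=\; L\cap\tfrac{1}{|p_2\widetilde p_2|}\,p_2L\widetilde p_2$$ if and only if both of the following conditions hold: 1. $|p_1|^2=|p_2|^2$ up to a unit of $\mathfrak{o}$, i.e. $|p_1|^2=\varepsilon\,|p_2|^2$ for some $\varepsilon\in\mathfrak{o}^\times$; 2. $\operatorname{glcd}\bigl(p_1,|p_1\widetilde p_1|/c\bigr)=\operatorname{glcd}\bigl(p_2,|p_2\widetilde p_2|/c\bigr)$ up to right multiplication by a unit of $\mathbb{I}$, where $c=\sqrt5$ if $|p_1|^2$ (equivalently, by the first condition, $|p_2|^2$) is divisible by $5$ in $\mathfrak{o}$, and $c=1$ otherwise. -/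

import Mathlib

/-!
Up to the real embedding, `L` is the lattice of twist-invariant icosians, and the coincidence
lattice of `p`, with `n = |p p̃|`, consists of the `x ∈ L` for which `p̄ x (p̄)~ / n` is again an
icosian. For the trace form, the dual of `L` is the image of the icosians under
`z ↦ (z - z̃) / √5`, and the dual of the coincidence lattice is the sum of this image and its own
image under `x ↦ p x p̃ / n`.

Multiplied by `n`, this dual lies in the right ideal `p 𝕀 + (n / √5) 𝕀`; conversely, since `p̃` is
primitive, every right `𝕀`-submodule containing the dual contains `p / n`. Hence equality of the
coincidence lattices of two icosians forces first the numbers `n` and then the ideals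
`p 𝕀 + (n / c) 𝕀` to agree; when `5 ∤ n`, the factor `√5` is removed by coprimality.

In the other direction, write `q = p s + (n / c) t` and expand `q̄ x (q̄)~ / n`. Up to an icosian
it equals `z + z̃` for `c = 1` and `(z - z̃) / √5` for `c = √5`, where `z = t̄ x (s̄ p̄)~`. The
latter is an icosian as soon as `√5` divides the norm of `z - z̃`, which follows from
`|q|² (|q|²)' = n²` by computing in the localisation of `𝔬` at `√5`.

Finally, `𝕀` is norm-Euclidean, so the generators of the right ideal `p 𝕀 + (n / c) 𝕀` are the
greatest left common divisors of `p` and `n / c`.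
-/

open scoped Quaternion

/-- The quadratic field `K = ℚ(√5)`, presented as `ℚ[ω]` with `ω ^ 2 = 5`; `star` is the
algebraic conjugation `√5 ↦ -√5`. -/
abbrev GoldenField : Type := QuadraticAlgebra ℚ 5 0

instance instFactGoldenField : Fact (∀ r : ℚ, r ^ 2 ≠ 5 + 0 * r) := ⟨by
  intro r hr
  have h5 : Irrational (Real.sqrt 5) := by
    simpa using (by norm_num : Nat.Prime 5).irrational_sqrt
  have hr' : (r : ℝ) ^ 2 = 5 := by
    have : r ^ 2 = 5 := by linarith
    exact_mod_cast this
  apply h5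
  refine ⟨|r|, ?_⟩
  rw [← hr', Real.sqrt_sq_eq_abs]
  push_cast
  rfl⟩

namespace GoldenField

/-- `√5` as an element of `K`. -/
def sqrtFive : GoldenField := ⟨0, 1⟩

/-- The golden ratio `τ = (1 + √5) / 2` as an element of `K`. -/
def tau : GoldenField := ⟨1 / 2, 1 / 2⟩

theorem tau_mul_tau : tau * tau = tau + 1 := by
  refine QuadraticAlgebra.ext ?_ ?_
  · change (1 / 2 * (1 / 2) + 5 * (1 / 2) * (1 / 2) : ℚ) = 1 / 2 + 1
    norm_num
  · change (1 / 2 * (1 / 2) + 1 / 2 * (1 / 2) + 0 * (1 / 2) * (1 / 2) : ℚ) = 1 / 2 + 0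
    norm_num

/-- The real embedding of `K` with `√5 ↦ √5 > 0`. -/
noncomputable def toReal : GoldenField →ₐ[ℚ] ℝ :=
  QuadraticAlgebra.lift ⟨Real.sqrt 5, by
    rw [Real.mul_self_sqrt (by norm_num), zero_smul, add_zero, Rat.smul_def]
    norm_num⟩

/-- The ring `𝔬 = ℤ[τ] = {m + n τ | m, n ∈ ℤ}`. -/
def integers : Subring GoldenField where
  carrier := {x | ∃ m n : ℤ, x = m + n * tau}
  mul_mem' := by
    rintro _ _ ⟨a, b, rfl⟩ ⟨c, d, rfl⟩
    refine ⟨a * c + b * d, a * d + b * c + b * d, ?_⟩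
    push_cast
    linear_combination (b * d : GoldenField) * tau_mul_tau
  one_mem' := ⟨1, 0, by simp⟩
  add_mem' := by
    rintro _ _ ⟨a, b, rfl⟩ ⟨c, d, rfl⟩
    exact ⟨a + c, b + d, by push_cast; ring⟩
  zero_mem' := ⟨0, 0, by simp⟩
  neg_mem' := by
    rintro _ ⟨a, b, rfl⟩
    exact ⟨-a, -b, by push_cast; ring⟩

end GoldenField

open GoldenField

/-- The icosian ring `𝕀`: the `𝔬`-linear combinations of `(1,0,0,0)`, `(0,1,0,0)`,
`(1,1,1,1)/2` and `(1-τ,τ,0,1)/2` in `ℍ(K)`. -/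
def icosians : Submodule integers ℍ[GoldenField] :=
  Submodule.span integers
    {⟨1, 0, 0, 0⟩, ⟨0, 1, 0, 0⟩, ⟨1 / 2, 1 / 2, 1 / 2, 1 / 2⟩,
      ⟨(1 - tau) / 2, tau / 2, 0, 1 / 2⟩}

/-- The twist map `(a,b,c,d) ↦ (a',b',d',c')`, with `'` the algebraic conjugation of `K`. -/
def twist (q : ℍ[GoldenField]) : ℍ[GoldenField] :=
  ⟨star q.re, star q.imI, star q.imK, star q.imJ⟩

/-- The inclusion of `ℍ(K)` into `ℍ(ℝ) = ℝ⁴`. -/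
noncomputable def quatToReal (q : ℍ[GoldenField]) : ℍ[ℝ] :=
  ⟨toReal q.re, toReal q.imI, toReal q.imJ, toReal q.imK⟩

/-- The Euclidean length `|q q̃|`. -/
noncomputable def twistLength (q : ℍ[GoldenField]) : ℝ :=
  ‖quatToReal (q * twist q)‖

/-- `q` is an icosian, and `α q` with `α ∈ K` is an icosian only for `α ∈ 𝔬`. -/
def IsPrimitiveIcosian (q : ℍ[GoldenField]) : Prop :=
  q ∈ icosians ∧ ∀ α : GoldenField, α • q ∈ icosians → α ∈ integers

/-- The realisation `L` in `ℝ⁴ = ℍ(ℝ)` of the root lattice `A₄` (rescaled by `1/√2`). -/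
noncomputable def latticeL : Submodule ℤ ℍ[ℝ] :=
  Submodule.span ℤ
    {⟨1, 0, 0, 0⟩, ⟨-1 / 2, 1 / 2, 1 / 2, 1 / 2⟩, ⟨0, -1, 0, 0⟩,
      ⟨0, 1 / 2, (Real.goldenRatio - 1) / 2, -Real.goldenRatio / 2⟩}

/-- The rotation `R(q) : x ↦ q x q̃ / |q q̃|` of `ℝ⁴ = ℍ(ℝ)`. -/
noncomputable def icosianRotation (q : ℍ[GoldenField]) : ℍ[ℝ] →ₗ[ℝ] ℍ[ℝ] :=
  (1 / twistLength q) •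
    (LinearMap.mulLeft ℝ (quatToReal q) ∘ₗ LinearMap.mulRight ℝ (quatToReal (twist q)))

/-- The lattice `L ∩ R(q) L`. -/
noncomputable def icosianCSL (q : ℍ[GoldenField]) : Submodule ℤ ℍ[ℝ] :=
  latticeL ⊓ latticeL.map ((icosianRotation q).restrictScalars ℤ)

/-- `d` is a left divisor of `a` in `𝕀`. -/
def IcosianLeftDvd (d a : ℍ[GoldenField]) : Prop :=
  ∃ x ∈ icosians, a = d * x

/-- `g` is a greatest left common divisor of `a` and `b` in `𝕀`. -/
def IsIcosianGLCD (g a b : ℍ[GoldenField]) : Prop :=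
  g ∈ icosians ∧ IcosianLeftDvd g a ∧ IcosianLeftDvd g b ∧
    ∀ d ∈ icosians, IcosianLeftDvd d a → IcosianLeftDvd d b → IcosianLeftDvd d g

open Classical in
/-- `c = √5` if `5` divides `|q|²` in `𝔬`, and `c = 1` otherwise. -/
noncomputable def fiveCorrection (q : ℍ[GoldenField]) : GoldenField :=
  if ∃ x ∈ integers, Quaternion.normSq q = 5 * x then sqrtFive else 1

namespace GoldenField

theorem star_tau : star tau = 1 - tau := by
  refine QuadraticAlgebra.ext ?_ ?_ <;>
    norm_num [tau, QuadraticAlgebra.re_one, QuadraticAlgebra.im_one]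

theorem sqrtFive_eq : sqrtFive = 2 * tau - 1 := by
  rw [two_mul]
  refine QuadraticAlgebra.ext ?_ ?_ <;>
    norm_num [tau, sqrtFive, QuadraticAlgebra.re_one, QuadraticAlgebra.im_one]

theorem star_sqrtFive : star sqrtFive = -sqrtFive := by
  refine QuadraticAlgebra.ext ?_ ?_ <;> simp [sqrtFive]

theorem sqrtFive_mul_sqrtFive : sqrtFive * sqrtFive = 5 := by
  rw [sqrtFive_eq]
  linear_combination 4 * tau_mul_tau

theorem sqrtFive_ne_zero : sqrtFive ≠ 0 := fun h => by
  simpa [h] using sqrtFive_mul_sqrtFive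

theorem tau_mem_integers : tau ∈ integers := ⟨0, 1, by simp⟩

theorem sqrtFive_mem_integers : sqrtFive ∈ integers :=
  ⟨-1, 2, by rw [sqrtFive_eq]; push_cast; ring⟩

theorem star_add_int_mul_tau (m n : ℤ) :
    star (m + n * tau : GoldenField) = (m + n : ℤ) - n * tau := by
  rw [star_add, star_mul', star_tau, star_intCast, star_intCast]
  push_cast
  ring

theorem star_mem_integers {x : GoldenField} (hx : x ∈ integers) : star x ∈ integers := by
  obtain ⟨m, n, rfl⟩ := hx
  exact ⟨m + n, -n, by rw [star_add_int_mul_tau]; push_cast; ring⟩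

theorem sub_star_eq_sqrtFive_mul {x : GoldenField} (hx : x ∈ integers) :
    ∃ k : ℤ, x - star x = sqrtFive * k := by
  obtain ⟨m, n, rfl⟩ := hx
  refine ⟨n, ?_⟩
  rw [star_add_int_mul_tau, sqrtFive_eq]
  push_cast
  ring

theorem intCast_eq_of_ratCast_mem_integers {r : ℚ} (h : (r : GoldenField) ∈ integers) :
    ∃ k : ℤ, r = k := by
  obtain ⟨m, n, h⟩ := h
  have hn : n = 0 := by simpa [tau] using congrArg QuadraticAlgebra.im h
  exact ⟨m, by simpa [hn] using congrArg QuadraticAlgebra.re h⟩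

theorem ratCast_norm (x : GoldenField) :
    ((QuadraticAlgebra.norm x : ℚ) : GoldenField) = x * star x :=
  QuadraticAlgebra.algebraMap_norm_eq_mul_star x

theorem norm_eq_intCast {x : GoldenField} (hx : x ∈ integers) :
    ∃ k : ℤ, QuadraticAlgebra.norm x = k :=
  intCast_eq_of_ratCast_mem_integers (ratCast_norm x ▸ mul_mem hx (star_mem_integers hx))

end GoldenField

/-! ### The icosian ring and the twist -/

/-- The quaternion with coordinates `a, b, c, d` in the `𝔬`-basis defining the icosian ring. -/
def icosianOf (a b c d : GoldenField) : ℍ[GoldenField] :=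
  ⟨a + c / 2 + d * (1 - tau) / 2, b + c / 2 + d * tau / 2, c / 2, c / 2 + d / 2⟩

theorem smul_mul_quaternion (a : GoldenField) (p q : ℍ[GoldenField]) :
    (a • p) * q = a • (p * q) :=
  Algebra.smul_mul_assoc a p q

theorem mul_smul_quaternion (a : GoldenField) (p q : ℍ[GoldenField]) :
    p * (a • q) = a • (p * q) :=
  Algebra.mul_smul_comm a p q

@[simp] theorem re_icosianOf (a b c d : GoldenField) :
    (icosianOf a b c d).re = a + c / 2 + d * (1 - tau) / 2 := rfl

@[simp] theorem imI_icosianOf (a b c d : GoldenField) :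
    (icosianOf a b c d).imI = b + c / 2 + d * tau / 2 := rfl

@[simp] theorem imJ_icosianOf (a b c d : GoldenField) : (icosianOf a b c d).imJ = c / 2 := rfl

@[simp] theorem imK_icosianOf (a b c d : GoldenField) :
    (icosianOf a b c d).imK = c / 2 + d / 2 := rfl

theorem icosianOf_sub_icosianOf (a b c d a' b' c' d' : GoldenField) :
    icosianOf a b c d - icosianOf a' b' c' d' = icosianOf (a - a') (b - b') (c - c') (d - d') := by
  apply Quaternion.ext <;> simp <;> ring

theorem smul_icosianOf (r a b c d : GoldenField) :
    r • icosianOf a b c d = icosianOf (r * a) (r * b) (r * c) (r * d) := by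
  apply Quaternion.ext <;> simp <;> ring

theorem eq_icosianOf (q : ℍ[GoldenField]) :
    q = icosianOf (q.re - q.imJ - (q.imK - q.imJ) * (1 - tau))
      (q.imI - q.imJ - (q.imK - q.imJ) * tau) (2 * q.imJ) (2 * (q.imK - q.imJ)) := by
  apply Quaternion.ext <;> simp <;> ring

theorem mem_span_four {R M : Type*} [Ring R] [AddCommGroup M] [Module R M] {x y z w q : M} :
    q ∈ Submodule.span R {x, y, z, w} ↔
      ∃ a b c d : R, a • x + b • y + c • z + d • w = q := by
  simp only [Submodule.mem_span_insert, Submodule.mem_span_singleton]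
  constructor
  · rintro ⟨a, _, ⟨b, _, ⟨c, _, ⟨d, rfl⟩, rfl⟩, rfl⟩, rfl⟩
    exact ⟨a, b, c, d, by abel⟩
  · rintro ⟨a, b, c, d, rfl⟩
    exact ⟨a, _, ⟨b, _, ⟨c, _, ⟨d, rfl⟩, rfl⟩, rfl⟩, by abel⟩

theorem icosianOf_inj {a b c d a' b' c' d' : GoldenField} :
    icosianOf a b c d = icosianOf a' b' c' d' ↔ a = a' ∧ b = b' ∧ c = c' ∧ d = d' := by
  refine ⟨fun h => ?_, by rintro ⟨rfl, rfl, rfl, rfl⟩; rfl⟩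
  obtain ⟨hR, hI, hJ, hK⟩ := Quaternion.ext_iff.1 h
  simp only [re_icosianOf, imI_icosianOf, imJ_icosianOf, imK_icosianOf] at hR hI hJ hK
  have hc : c = c' := by linear_combination 2 * hJ
  have hd : d = d' := by linear_combination 2 * hK - hc
  subst hc hd
  exact ⟨by linear_combination hR, by linear_combination hI, rfl, rfl⟩

theorem icosianOf_mem_icosians_iff {a b c d : GoldenField} :
    icosianOf a b c d ∈ icosians ↔
      a ∈ integers ∧ b ∈ integers ∧ c ∈ integers ∧ d ∈ integers := by
  have smul_basis (a b c d : integers) :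
      a • (⟨1, 0, 0, 0⟩ : ℍ[GoldenField]) + b • ⟨0, 1, 0, 0⟩ + c • ⟨1 / 2, 1 / 2, 1 / 2, 1 / 2⟩ +
        d • ⟨(1 - tau) / 2, tau / 2, 0, 1 / 2⟩ = icosianOf a b c d := by
    apply Quaternion.ext <;> simp [Subring.smul_def] <;> ring
  refine mem_span_four.trans ⟨?_, ?_⟩
  · rintro ⟨a', b', c', d', h⟩
    obtain ⟨rfl, rfl, rfl, rfl⟩ := icosianOf_inj.1 ((smul_basis a' b' c' d').symm.trans h)
    exact ⟨a'.2, b'.2, c'.2, d'.2⟩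
  · rintro ⟨ha, hb, hc, hd⟩
    exact ⟨⟨a, ha⟩, ⟨b, hb⟩, ⟨c, hc⟩, ⟨d, hd⟩, smul_basis _ _ _ _⟩

theorem mem_icosians_iff {q : ℍ[GoldenField]} :
    q ∈ icosians ↔ ∃ a b c d : integers, icosianOf a b c d = q := by
  constructor
  · intro hq
    rw [eq_icosianOf q] at hq ⊢
    obtain ⟨ha, hb, hc, hd⟩ := icosianOf_mem_icosians_iff.1 hq
    exact ⟨⟨_, ha⟩, ⟨_, hb⟩, ⟨_, hc⟩, ⟨_, hd⟩, rfl⟩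
  · rintro ⟨a, b, c, d, rfl⟩
    exact icosianOf_mem_icosians_iff.2 ⟨a.2, b.2, c.2, d.2⟩

theorem star_icosianOf (a b c d : GoldenField) :
    star (icosianOf a b c d) = icosianOf (a + c + (1 - tau) * d) (-b) (-c) (-d) := by
  apply Quaternion.ext <;> simp <;> ring

theorem star_mem_icosians {q : ℍ[GoldenField]} (hq : q ∈ icosians) : star q ∈ icosians := by
  obtain ⟨a, b, c, d, rfl⟩ := mem_icosians_iff.1 hq
  rw [star_icosianOf, icosianOf_mem_icosians_iff]
  exact ⟨add_mem (add_mem a.2 c.2) (mul_mem (sub_mem (one_mem _) tau_mem_integers) d.2),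
    neg_mem b.2, neg_mem c.2, neg_mem d.2⟩

theorem mul_mem_icosians {p q : ℍ[GoldenField]} (hp : p ∈ icosians) (hq : q ∈ icosians) :
    p * q ∈ icosians := by
  obtain ⟨a₁, b₁, c₁, d₁, rfl⟩ := mem_icosians_iff.1 hp
  obtain ⟨a₂, b₂, c₂, d₂, rfl⟩ := mem_icosians_iff.1 hq
  have hτ := tau_mul_tau
  let t : integers := ⟨tau, tau_mem_integers⟩
  refine mem_icosians_iff.2 ⟨
    (a₁ * a₂ - b₁ * b₂ + (-1 + t) * b₁ * c₂ - t * c₁ * b₂ - c₁ * c₂ - c₁ * d₂ - t * d₁ * b₂ -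
      d₁ * d₂),
    (a₁ * b₂ + b₁ * a₂ + (1 - t) * b₁ * c₂ + (1 - t) * b₁ * d₂ + t * c₁ * b₂ + c₁ * d₂ -
      d₁ * c₂),
    (a₁ * c₂ - b₁ * c₂ - b₁ * d₂ + c₁ * a₂ + c₁ * b₂ + c₁ * c₂ + d₁ * b₂ + (1 - t) * d₁ * c₂),
    (a₁ * d₂ + (b₁ * c₂ + b₁ * c₂) + b₁ * d₂ - (c₁ * b₂ + c₁ * b₂) + (1 - t) * c₁ * d₂ +
      d₁ * a₂ - d₁ * b₂ + t * d₁ * c₂ + (1 - t) * d₁ * d₂), ?_⟩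
  apply Quaternion.ext <;> simp [t] <;> grind

theorem smul_mem_icosians {a : GoldenField} {q : ℍ[GoldenField]} (ha : a ∈ integers)
    (hq : q ∈ icosians) : a • q ∈ icosians :=
  icosians.smul_mem ⟨a, ha⟩ hq

theorem coe_mem_icosians_iff {a : GoldenField} :
    (a : ℍ[GoldenField]) ∈ icosians ↔ a ∈ integers := by
  rw [show (a : ℍ[GoldenField]) = icosianOf a 0 0 0 by apply Quaternion.ext <;> simp,
    icosianOf_mem_icosians_iff]
  simp [zero_mem]

theorem one_mem_icosians : (1 : ℍ[GoldenField]) ∈ icosians :=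
  coe_mem_icosians_iff.2 (one_mem _)

/-- The icosian ring as a subring of the quaternion algebra. -/
def icosianRing : Subring ℍ[GoldenField] where
  carrier := icosians
  mul_mem' := mul_mem_icosians
  one_mem' := one_mem_icosians
  add_mem' := add_mem
  zero_mem' := zero_mem _
  neg_mem' := neg_mem

theorem normSq_mem_integers {q : ℍ[GoldenField]} (hq : q ∈ icosians) :
    Quaternion.normSq q ∈ integers := by
  rw [← coe_mem_icosians_iff, ← Quaternion.self_mul_star]
  exact mul_mem_icosians hq (star_mem_icosians hq)

@[simp] theorem re_twist (q : ℍ[GoldenField]) : (twist q).re = star q.re := rfl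

@[simp] theorem imI_twist (q : ℍ[GoldenField]) : (twist q).imI = star q.imI := rfl

@[simp] theorem imJ_twist (q : ℍ[GoldenField]) : (twist q).imJ = star q.imK := rfl

@[simp] theorem imK_twist (q : ℍ[GoldenField]) : (twist q).imK = star q.imJ := rfl

theorem twist_icosianOf (a b c d : GoldenField) :
    twist (icosianOf a b c d) = icosianOf (star a) (star b) (star c + star d) (-star d) := by
  apply Quaternion.ext <;> simp [star_tau, star_div₀] <;> ring

theorem twist_mem_icosians {q : ℍ[GoldenField]} (hq : q ∈ icosians) : twist q ∈ icosians := by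
  obtain ⟨a, b, c, d, rfl⟩ := mem_icosians_iff.1 hq
  rw [twist_icosianOf, icosianOf_mem_icosians_iff]
  exact ⟨star_mem_integers a.2, star_mem_integers b.2,
    add_mem (star_mem_integers c.2) (star_mem_integers d.2), neg_mem (star_mem_integers d.2)⟩

theorem twist_add (p q : ℍ[GoldenField]) : twist (p + q) = twist p + twist q := by
  apply Quaternion.ext <;> simp

theorem twist_sub (p q : ℍ[GoldenField]) : twist (p - q) = twist p - twist q := by
  apply Quaternion.ext <;> simp

theorem twist_mul (p q : ℍ[GoldenField]) : twist (p * q) = twist q * twist p := by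
  apply Quaternion.ext <;>
    simp only [re_twist, imI_twist, imJ_twist, imK_twist, Quaternion.re_mul, Quaternion.imI_mul,
      Quaternion.imJ_mul, Quaternion.imK_mul, star_add, star_sub, star_mul'] <;>
    ring

theorem twist_smul (a : GoldenField) (q : ℍ[GoldenField]) :
    twist (a • q) = star a • twist q := by
  apply Quaternion.ext <;> simp

theorem twist_twist (q : ℍ[GoldenField]) : twist (twist q) = q := by
  apply Quaternion.ext <;> simp

theorem twist_star (q : ℍ[GoldenField]) : twist (star q) = star (twist q) := by
  apply Quaternion.ext <;> simp

theorem normSq_twist (q : ℍ[GoldenField]) :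
    Quaternion.normSq (twist q) = star (Quaternion.normSq q) := by
  simp only [Quaternion.normSq_def', re_twist, imI_twist, imJ_twist, imK_twist, star_add, star_pow]
  ring

/-! ### Norm-Euclidean subrings -/

/-- `S` is right Euclidean in `A` for the multiplicative function `N`, which has natural values on
`S`: every element of `A` is at `N`-distance less than `1` from `S`. The nonzero elements of `A`
are invertible, so that elements of `S` may be divided by each other in `A`. -/
structure IsNormEuclidean {A : Type*} [Ring A] (S : Subring A) (N : A →* ℚ) : Prop where
  isUnit_of_ne_zero : ∀ x : A, x ≠ 0 → IsUnit x
  exists_eq_natCast : ∀ x ∈ S, ∃ k : ℕ, N x = k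
  exists_sub_lt_one : ∀ x : A, ∃ y ∈ S, N (x - y) < 1

theorem IsNormEuclidean.exists_generator {A : Type*} [Ring A] {S : Subring A} {N : A →* ℚ}
    (hN : IsNormEuclidean S N) {I : AddSubgroup A} (hIS : ∀ x ∈ I, x ∈ S)
    (hI : ∀ x ∈ I, ∀ y ∈ S, x * y ∈ I) :
    ∃ g ∈ I, ∀ x ∈ I, ∃ y ∈ S, x = g * y := by
  classical
  by_cases h0 : ∃ x ∈ I, x ≠ 0
  · have hex : ∃ k : ℕ, ∃ x ∈ I, x ≠ 0 ∧ N x = k := by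
      obtain ⟨x, hx, hx0⟩ := h0
      obtain ⟨k, hk⟩ := hN.exists_eq_natCast x (hIS x hx)
      exact ⟨k, x, hx, hx0, hk⟩
    obtain ⟨g, hg, hg0, hNg⟩ := Nat.find_spec hex
    obtain ⟨u, rfl⟩ := hN.isUnit_of_ne_zero g hg0
    refine ⟨u, hg, fun x hx => ?_⟩
    obtain ⟨y, hy, hlt⟩ := hN.exists_sub_lt_one (↑u⁻¹ * x)
    refine ⟨y, hy, sub_eq_zero.1 (by_contra fun hr0 => ?_)⟩
    have hrI : x - u * y ∈ I := sub_mem hx (hI _ hg y hy)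
    have hr : x - u * y = u * (↑u⁻¹ * x - y) := by rw [mul_sub, Units.mul_inv_cancel_left]
    obtain ⟨k, hk⟩ := hN.exists_eq_natCast _ (hIS _ hrI)
    have hNu : 0 < N u :=
      lt_of_le_of_ne (hNg ▸ Nat.cast_nonneg _) (u.isUnit.map N).ne_zero.symm
    have hlt' : (k : ℚ) < (Nat.find hex : ℕ) := by
      rw [← hk, hr, map_mul, ← hNg]
      exact mul_lt_of_lt_one_right hNu hlt
    exact Nat.find_min hex (by exact_mod_cast hlt') ⟨_, hrI, hr0, hk⟩
  · push Not at h0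
    exact ⟨0, zero_mem _, fun x hx => ⟨0, zero_mem _, by rw [h0 x hx, mul_zero]⟩⟩

namespace GoldenField

/-- The absolute value of the field norm of `K`, the size function for Euclidean division. -/
def absNorm : GoldenField →* ℚ := (absHom : ℚ →*₀ ℚ).toMonoidHom.comp QuadraticAlgebra.norm

theorem absNorm_apply (x : GoldenField) : absNorm x = |QuadraticAlgebra.norm x| := rfl

theorem exists_absNorm_eq_natCast {x : GoldenField} (hx : x ∈ integers) :
    ∃ k : ℕ, absNorm x = k := by
  obtain ⟨k, hk⟩ := norm_eq_intCast hx
  exact ⟨k.natAbs, by rw [absNorm_apply, hk, Nat.cast_natAbs, Int.cast_abs]⟩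

theorem exists_absNorm_sub_lt_one (x : GoldenField) : ∃ y ∈ integers, absNorm (x - y) < 1 := by
  obtain ⟨u, v⟩ := x
  refine ⟨(round (u - v) : GoldenField) + round (2 * v) * tau, ⟨_, _, rfl⟩, ?_⟩
  set s := u - v - round (u - v) with hs
  set t := 2 * v - round (2 * v) with ht
  have h : (⟨u, v⟩ : GoldenField) - (round (u - v) + round (2 * v) * tau) =
      ⟨s + t / 2, t / 2⟩ := by
    refine QuadraticAlgebra.ext ?_ ?_ <;> simp [tau, hs, ht] <;> ring
  have hs' : |s| ≤ 1 / 2 := abs_sub_round _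
  have ht' : |t| ≤ 1 / 2 := abs_sub_round _
  rw [absNorm_apply, h, QuadraticAlgebra.norm_def]
  rw [abs_le] at hs' ht'
  rw [abs_lt]
  constructor <;> nlinarith

theorem isNormEuclidean_integers : IsNormEuclidean integers absNorm where
  isUnit_of_ne_zero _ := IsUnit.mk0 _
  exists_eq_natCast _ := exists_absNorm_eq_natCast
  exists_sub_lt_one := exists_absNorm_sub_lt_one

instance : IsPrincipalIdealRing integers where
  principal J := by
    obtain ⟨_, ⟨g, hg, rfl⟩, hJ⟩ := isNormEuclidean_integers.exists_generator
      (I := J.toAddSubgroup.map integers.subtype.toAddMonoidHom)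
      (by rintro _ ⟨x, -, rfl⟩; exact x.2)
      (by rintro _ ⟨x, hx, rfl⟩ y hy; exact ⟨x * ⟨y, hy⟩, J.mul_mem_right _ hx, rfl⟩)
    refine ⟨g, le_antisymm (fun x hx => ?_) ((Ideal.span_singleton_le_iff_mem J).2 hg)⟩
    obtain ⟨y, hy, h⟩ := hJ x ⟨x, hx, rfl⟩
    exact Ideal.mem_span_singleton.2 ⟨⟨y, hy⟩, Subtype.ext h⟩

end GoldenField

/-! ### The icosian ring is norm-Euclidean -/

theorem exists_opposite_parity_sub_sq_le_one (x : ℚ) :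
    ∃ z : ℤ, (z : ZMod 2) = (round x : ℤ) + 1 ∧ (x - z) ^ 2 ≤ 1 := by
  have h := abs_le.1 (abs_sub_round x)
  rcases le_total 0 (x - round x) with h0 | h0
  · exact ⟨round x + 1, by push_cast; rfl, by push_cast; nlinarith⟩
  · exact ⟨round x - 1, by push_cast; exact CharTwo.sub_eq_add _ _, by push_cast; nlinarith⟩

-- Round every coordinate, then repair the syndrome by moving at most `r` coordinates to the
-- nearest integer of the opposite parity: their squared error grows from `1 / 4` to at most `1`.
theorem exists_mulVec_eq_zero_sum_sq_sub_le {ι κ : Type*} [Fintype ι]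
    (H : Matrix κ ι (ZMod 2)) {r : ℕ}
    (hH : ∀ s : κ → ZMod 2, ∃ e : Finset ι, e.card ≤ r ∧ H.mulVec (Set.indicator e 1) = s)
    (x : ι → ℚ) :
    ∃ z : ι → ℤ, H.mulVec (fun i => (z i : ZMod 2)) = 0 ∧
      ∑ i, (x i - z i) ^ 2 ≤ (Fintype.card ι + 3 * r) / 4 := by
  classical
  choose z' hz'2 hz' using exists_opposite_parity_sub_sq_le_one
  obtain ⟨e, he, hs⟩ := hH (H.mulVec fun i => ((round (x i) : ℤ) : ZMod 2))
  refine ⟨fun i => if i ∈ e then z' (x i) else round (x i), ?_, ?_⟩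
  · have hz : (fun i => ((if i ∈ e then z' (x i) else round (x i) : ℤ) : ZMod 2)) =
        (fun i => ((round (x i) : ℤ) : ZMod 2)) + Set.indicator e 1 := by
      ext i
      by_cases hi : i ∈ e <;> simp [hi, hz'2]
    rw [hz, Matrix.mulVec_add, hs]
    exact funext fun _ => CharTwo.add_self_eq_zero _
  · have hsq (i : ι) : (x i - (if i ∈ e then z' (x i) else round (x i) : ℤ)) ^ 2 ≤
        1 / 4 + if i ∈ e then 3 / 4 else 0 := by
      have h := abs_le.1 (abs_sub_round (x i))
      by_cases hi : i ∈ e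
      · simp only [hi, if_true]
        linarith [hz' (x i)]
      · simp only [hi, if_false]
        nlinarith
    have he' : (e.card : ℚ) ≤ r := by exact_mod_cast he
    refine (Finset.sum_le_sum fun i _ => hsq i).trans ?_
    rw [Finset.sum_add_distrib, Finset.sum_const, Finset.sum_ite_mem, Finset.univ_inter,
      Finset.sum_const, Finset.card_univ, nsmul_eq_mul, nsmul_eq_mul]
    linarith

/-- A parity-check matrix of the `[8, 4]` Hamming code. Its columns record which half-integral
golden coordinates `icosianCoords` belong to icosians. -/
def hammingMatrix : Matrix (Fin 4) (Fin 8) (ZMod 2) :=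
  !![1, 1, 0, 0, 0, 1, 1, 0; 0, 1, 0, 0, 1, 0, 1, 1; 0, 0, 1, 1, 1, 0, 0, 1; 0, 0, 0, 1, 1, 1, 1, 0]

theorem hammingMatrix_mulVec (v : Fin 8 → ZMod 2) :
    hammingMatrix.mulVec v = ![v 0 + v 1 + v 5 + v 6, v 1 + v 4 + v 6 + v 7,
      v 2 + v 3 + v 4 + v 7, v 3 + v 4 + v 5 + v 6] := by
  ext i
  fin_cases i <;> simp [hammingMatrix, Matrix.mulVec, dotProduct, Fin.sum_univ_eight]

theorem even_of_hammingMatrix_mulVec_eq_zero {z : Fin 8 → ℤ}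
    (hz : hammingMatrix.mulVec (fun i => (z i : ZMod 2)) = 0) :
    Even (z 0 + z 1 + z 5 + z 6) ∧ Even (z 1 + z 4 + z 6 + z 7) ∧
      Even (z 2 + z 3 + z 4 + z 7) ∧ Even (z 3 + z 4 + z 5 + z 6) := by
  rw [hammingMatrix_mulVec] at hz
  simp only [← ZMod.intCast_eq_zero_iff_even, Int.cast_add]
  exact ⟨congrFun hz 0, congrFun hz 1, congrFun hz 2, congrFun hz 3⟩

theorem hammingMatrix_covering (s : Fin 4 → ZMod 2) :
    ∃ e : Finset (Fin 8), e.card ≤ 2 ∧ hammingMatrix.mulVec (Set.indicator e 1) = s := by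
  have : s = 0 ∨ ∃ i j : Fin 8,
      hammingMatrix.mulVec (fun k => if k = i ∨ k = j then 1 else 0) = s := by
    revert s
    decide
  rcases this with rfl | ⟨i, j, hij⟩
  · exact ⟨∅, by simp, by
      rw [Finset.coe_empty, Set.indicator_empty]
      exact Matrix.mulVec_zero _⟩
  · refine ⟨{i, j}, Finset.card_le_two, hij ▸ congrArg _ (funext fun k => ?_)⟩
    simp [Set.indicator_apply]

namespace GoldenField

theorem toReal_injective : Function.Injective toReal := toReal.toRingHom.injective

end GoldenField

theorem toReal_normSq (q : ℍ[GoldenField]) :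
    toReal (Quaternion.normSq q) =
      toReal q.re ^ 2 + toReal q.imI ^ 2 + toReal q.imJ ^ 2 + toReal q.imK ^ 2 := by
  simp only [Quaternion.normSq_def', map_add, map_pow]

theorem eq_zero_of_normSq_eq_zero {q : ℍ[GoldenField]} (h : Quaternion.normSq q = 0) : q = 0 := by
  have hsum := toReal_normSq q
  rw [h, map_zero] at hsum
  have eq_zero {x : GoldenField} (hx : toReal x ^ 2 ≤ 0) : x = 0 :=
    toReal_injective <|
      (pow_eq_zero_iff two_ne_zero).1 (le_antisymm hx (sq_nonneg _)) |>.trans (map_zero _).symm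
  have hre := sq_nonneg (toReal q.re)
  have hI := sq_nonneg (toReal q.imI)
  have hJ := sq_nonneg (toReal q.imJ)
  have hK := sq_nonneg (toReal q.imK)
  apply Quaternion.ext <;> exact eq_zero (by linarith)

theorem norm_normSq_nonneg (q : ℍ[GoldenField]) :
    0 ≤ QuadraticAlgebra.norm (Quaternion.normSq q) := by
  have h : ((QuadraticAlgebra.norm (Quaternion.normSq q) : ℚ) : ℝ) =
      toReal (Quaternion.normSq q) * toReal (Quaternion.normSq (twist q)) := by
    rw [normSq_twist, ← map_mul, ← ratCast_norm, map_ratCast]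
  have h0 : (0 : ℝ) ≤ (QuadraticAlgebra.norm (Quaternion.normSq q) : ℚ) := by
    rw [h, toReal_normSq, toReal_normSq]
    positivity
  exact_mod_cast h0

/-- The rational coordinates `s₀, t₀, …, s₃, t₃` of a quaternion whose four components are
`((sᵢ - tᵢ) + tᵢ τ) / 2`. They diagonalize the form `Q` with `|q|² = P + R √5`, `Q = P + R`, which
dominates the norm, and they are integral on icosians. -/
def icosianCoords (q : ℍ[GoldenField]) : Fin 8 → ℚ :=
  ![2 * (q.re.re + q.re.im), 4 * q.re.im, 2 * (q.imI.re + q.imI.im), 4 * q.imI.im,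
    2 * (q.imJ.re + q.imJ.im), 4 * q.imJ.im, 2 * (q.imK.re + q.imK.im), 4 * q.imK.im]

theorem icosianCoords_sub (p q : ℍ[GoldenField]) :
    icosianCoords (p - q) = icosianCoords p - icosianCoords q := by
  ext i
  fin_cases i <;> simp [icosianCoords] <;> ring

theorem icosianCoords_surjective : Function.Surjective icosianCoords := by
  intro v
  refine ⟨⟨⟨v 0 / 2 - v 1 / 4, v 1 / 4⟩, ⟨v 2 / 2 - v 3 / 4, v 3 / 4⟩,
    ⟨v 4 / 2 - v 5 / 4, v 5 / 4⟩, ⟨v 6 / 2 - v 7 / 4, v 7 / 4⟩⟩, ?_⟩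
  ext i
  fin_cases i <;> simp [icosianCoords] <;> ring

theorem norm_normSq_le (q : ℍ[GoldenField]) :
    QuadraticAlgebra.norm (Quaternion.normSq q) ≤ 5 / 64 * (∑ i, icosianCoords q i ^ 2) ^ 2 := by
  have hsum : ∑ i, icosianCoords q i ^ 2 =
      4 * ((Quaternion.normSq q).re + (Quaternion.normSq q).im) := by
    simp only [icosianCoords, pow_two, Fin.sum_univ_eight, Matrix.cons_val_zero,
      Matrix.cons_val_one, Matrix.cons_val, Quaternion.normSq_def', QuadraticAlgebra.re_add,
      QuadraticAlgebra.re_mul, QuadraticAlgebra.im_add, QuadraticAlgebra.im_mul, zero_mul, add_zero]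
    ring
  rw [hsum, QuadraticAlgebra.norm_def]
  nlinarith [sq_nonneg ((Quaternion.normSq q).re + 5 * (Quaternion.normSq q).im)]

theorem mem_icosians_of_icosianCoords {q : ℍ[GoldenField]} {z : Fin 8 → ℤ}
    (hq : ∀ i, icosianCoords q i = z i)
    (hz : hammingMatrix.mulVec (fun i => (z i : ZMod 2)) = 0) : q ∈ icosians := by
  have two_mul_eq {x : GoldenField} {s t : ℤ} (hs : 2 * (x.re + x.im) = s) (ht : 4 * x.im = t) :
      2 * x = (s - t) + t * tau := by
    rw [two_mul]
    refine QuadraticAlgebra.ext ?_ ?_ <;> simp [tau] <;> linarith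
  have hR := two_mul_eq (hq 0) (hq 1)
  have hI := two_mul_eq (hq 2) (hq 3)
  have hJ := two_mul_eq (hq 4) (hq 5)
  have hK := two_mul_eq (hq 6) (hq 7)
  obtain ⟨⟨w₀, h₀⟩, ⟨w₁, h₁⟩, ⟨w₂, h₂⟩, ⟨w₃, h₃⟩⟩ := even_of_hammingMatrix_mulVec_eq_zero hz
  apply_fun ((↑) : ℤ → GoldenField) at h₀ h₁ h₂ h₃
  push_cast at h₀ h₁ h₂ h₃
  have hτ := tau_mul_tau
  rw [eq_icosianOf q, icosianOf_mem_icosians_iff]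
  refine ⟨⟨w₀ - z 1 - z 5 - z 6 + z 7, w₁ - z 4 - z 7, ?_⟩,
    ⟨w₂ - z 3 - z 4 + z 5 - z 7, w₃ - z 5 - z 6, ?_⟩, ⟨z 4 - z 5, z 5, ?_⟩,
    ⟨z 6 - z 7 - (z 4 - z 5), z 7 - z 5, ?_⟩⟩
  · grind
  · grind
  · rw [hJ]; push_cast; ring
  · rw [mul_sub, hJ, hK]; push_cast; ring

theorem exists_absNorm_normSq_sub_lt_one (x : ℍ[GoldenField]) :
    ∃ y ∈ icosians, absNorm (Quaternion.normSq (x - y)) < 1 := by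
  obtain ⟨z, hz, hxz⟩ := exists_mulVec_eq_zero_sum_sq_sub_le hammingMatrix hammingMatrix_covering
    (icosianCoords x)
  obtain ⟨y, hy⟩ := icosianCoords_surjective fun i => (z i : ℚ)
  refine ⟨y, mem_icosians_of_icosianCoords (congrFun hy) hz, ?_⟩
  rw [absNorm_apply, abs_of_nonneg (norm_normSq_nonneg _)]
  refine (norm_normSq_le _).trans_lt ?_
  have hsum : ∑ i, icosianCoords (x - y) i ^ 2 ≤ 7 / 2 := by
    simp only [icosianCoords_sub, hy, Pi.sub_apply]
    exact hxz.trans (by norm_num)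
  have hsum0 : 0 ≤ ∑ i, icosianCoords (x - y) i ^ 2 := Finset.sum_nonneg fun _ _ => sq_nonneg _
  nlinarith

theorem isNormEuclidean_icosianRing :
    IsNormEuclidean icosianRing (absNorm.comp Quaternion.normSq.toMonoidHom) where
  isUnit_of_ne_zero x hx := by
    have hn : Quaternion.normSq x ≠ 0 := fun h => hx (eq_zero_of_normSq_eq_zero h)
    exact isUnit_iff_exists.2 ⟨(Quaternion.normSq x)⁻¹ • star x, by
      rw [mul_smul_quaternion, Quaternion.self_mul_star, Quaternion.smul_coe,
        inv_mul_cancel₀ hn, Quaternion.coe_one], by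
      rw [smul_mul_quaternion, Quaternion.star_mul_self, Quaternion.smul_coe,
        inv_mul_cancel₀ hn, Quaternion.coe_one]⟩
  exists_eq_natCast _ hx := exists_absNorm_eq_natCast (normSq_mem_integers hx)
  exists_sub_lt_one := exists_absNorm_normSq_sub_lt_one

/-! ### The prime `√5` -/

theorem mem_of_coprime_nsmul_mem {M : Type*} [AddCommGroup M] (S : AddSubgroup M) {m k : ℕ}
    (h : m.Coprime k) {x : M} (hm : m • x ∈ S) (hk : k • x ∈ S) : x ∈ S := by
  have hx : x = m.gcdA k • (m • x) + m.gcdB k • (k • x) := by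
    rw [← natCast_zsmul, ← natCast_zsmul, smul_smul, smul_smul, ← add_smul, mul_comm _ (m : ℤ),
      mul_comm _ (k : ℤ), ← Nat.gcd_eq_gcd_ab, h.gcd_eq_one, Nat.cast_one, one_smul]
  rw [hx]
  exact add_mem (S.zsmul_mem hm _) (S.zsmul_mem hk _)

namespace GoldenField

theorem five_dvd_of_sqrtFive_inv_mul_mem_integers {k : ℤ}
    (h : sqrtFive⁻¹ * (k : GoldenField) ∈ integers) : (5 : ℤ) ∣ k := by
  obtain ⟨l, hl⟩ := norm_eq_intCast h
  have hkl : ((k ^ 2 : ℤ) : GoldenField) = (5 * -l : ℤ) := by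
    have h' := congrArg (Rat.cast : ℚ → GoldenField) hl
    rw [ratCast_norm, star_mul', star_inv₀, star_sqrtFive, star_intCast] at h'
    push_cast at h' ⊢
    rw [← h', ← sqrtFive_mul_sqrtFive]
    field_simp [sqrtFive_ne_zero]
  exact Int.Prime.dvd_pow' (by norm_num) (n := k) (k := 2) ⟨-l, by exact_mod_cast hkl⟩

theorem sqrtFive_inv_mul_mem_integers {a : GoldenField} (ha : a ∈ integers) {k : ℤ}
    (h : a * star a = 5 * k) : sqrtFive⁻¹ * a ∈ integers := by
  obtain ⟨m, n, rfl⟩ := ha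
  have h' : (((2 * m + n) ^ 2 : ℤ) : GoldenField) = ((5 * (n ^ 2 + 4 * k) : ℤ) : GoldenField) := by
    rw [star_add_int_mul_tau] at h
    push_cast at h ⊢
    linear_combination 4 * h + (4 * n ^ 2 : GoldenField) * tau_mul_tau
  obtain ⟨l, hl⟩ : (5 : ℤ) ∣ 2 * m + n :=
    Int.Prime.dvd_pow' (by norm_num) (k := 2) ⟨n ^ 2 + 4 * k, by exact_mod_cast h'⟩
  obtain rfl : n = 5 * l - 2 * m := by omega
  refine ⟨2 * l - m, l, ?_⟩
  rw [inv_mul_eq_iff_eq_mul₀ sqrtFive_ne_zero, sqrtFive_eq]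
  push_cast
  linear_combination (-2 * l : GoldenField) * tau_mul_tau

theorem exists_eq_five_mul {a : GoldenField} (ha : a ∈ integers) {k : ℕ}
    (h : a * star a = (5 * k : ℕ) ^ 2) :
    ∃ c ∈ integers, a = 5 * c ∧ c * star c = (k : GoldenField) ^ 2 := by
  have h5 := sqrtFive_mul_sqrtFive
  have h0 := sqrtFive_ne_zero
  push_cast at h
  have hb := sqrtFive_inv_mul_mem_integers ha (k := 5 * k ^ 2) (by rw [h]; push_cast; ring)
  have hbb : sqrtFive⁻¹ * a * star (sqrtFive⁻¹ * a) = 5 * (-k ^ 2 : ℤ) := by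
    rw [star_mul', star_inv₀, star_sqrtFive]
    push_cast
    field_simp
    linear_combination -h + 5 * (k : GoldenField) ^ 2 * h5
  refine ⟨_, sqrtFive_inv_mul_mem_integers hb hbb, ?_, ?_⟩
  · field_simp
    linear_combination a * h5
  · rw [star_mul', mul_mul_mul_comm, hbb, star_inv₀, star_sqrtFive]
    push_cast
    field_simp
    linear_combination -(k : GoldenField) ^ 2 * h5

theorem exists_eq_five_mul_iff {a : GoldenField} (ha : a ∈ integers) {n : ℕ}
    (h : a * star a = n ^ 2) : (∃ x ∈ integers, a = 5 * x) ↔ 5 ∣ n := by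
  constructor
  · rintro ⟨x, hx, rfl⟩
    have hn : sqrtFive⁻¹ * ((n ^ 2 : ℤ) : GoldenField) ∈ integers := by
      have hx' : sqrtFive⁻¹ * ((n ^ 2 : ℤ) : GoldenField) = 5 * sqrtFive * (x * star x) := by
        rw [inv_mul_eq_iff_eq_mul₀ sqrtFive_ne_zero]
        push_cast
        rw [← h, star_mul', star_ofNat]
        linear_combination (-5 * x * star x) * sqrtFive_mul_sqrtFive
      rw [hx']
      exact mul_mem (mul_mem (ofNat_mem _ 5) sqrtFive_mem_integers)
        (mul_mem hx (star_mem_integers hx))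
    exact_mod_cast Int.Prime.dvd_pow' (by norm_num) (five_dvd_of_sqrtFive_inv_mul_mem_integers hn)
  · rintro ⟨k, rfl⟩
    obtain ⟨c, hc, hac, -⟩ := exists_eq_five_mul ha h
    exact ⟨c, hc, hac⟩

/-- The localisation of `𝔬` at its prime `√5`. Integers prime to `5` suffice as denominators, since
`√5` is the only prime above `5`. -/
def localIntegers : Subring GoldenField where
  carrier := {a | ∃ m : ℕ, m.Coprime 5 ∧ m * a ∈ integers}
  mul_mem' := by
    rintro a b ⟨m, hm, ha⟩ ⟨k, hk, hb⟩
    refine ⟨m * k, hm.mul_left hk, ?_⟩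
    rw [Nat.cast_mul, mul_mul_mul_comm]
    exact mul_mem ha hb
  one_mem' := ⟨1, Nat.coprime_one_left 5, by simp [one_mem]⟩
  add_mem' := by
    rintro a b ⟨m, hm, ha⟩ ⟨k, hk, hb⟩
    refine ⟨m * k, hm.mul_left hk, ?_⟩
    rw [show ((m * k : ℕ) : GoldenField) * (a + b) = k * (m * a) + m * (k * b) by
      push_cast; ring]
    exact add_mem (mul_mem (natCast_mem _ k) ha) (mul_mem (natCast_mem _ m) hb)
  zero_mem' := ⟨1, Nat.coprime_one_left 5, by simp [zero_mem]⟩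
  neg_mem' := by
    rintro a ⟨m, hm, ha⟩
    exact ⟨m, hm, by rw [mul_neg]; exact neg_mem ha⟩

theorem integers_le_localIntegers : integers ≤ localIntegers := fun a ha =>
  ⟨1, Nat.coprime_one_left 5, by simpa using ha⟩

theorem mem_integers_of_mem_localIntegers {a : GoldenField} (ha : a ∈ localIntegers)
    (h5 : 5 * a ∈ integers) : a ∈ integers := by
  obtain ⟨m, hm, hma⟩ := ha
  exact mem_of_coprime_nsmul_mem integers.toAddSubgroup hm (by simpa using hma) (by simpa using h5)

-- The valuations of `a` and `n` at `√5` agree, because conjugation fixes this prime.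
theorem div_natCast_mem_localIntegers {a : GoldenField} (ha : a ∈ integers) {n : ℕ} (hn : 0 < n)
    (h : a * star a = n ^ 2) : a / n ∈ localIntegers := by
  induction n using Nat.strong_induction_on generalizing a with
  | _ n ih =>
    by_cases h5 : 5 ∣ n
    · obtain ⟨k, rfl⟩ := h5
      obtain ⟨c, hc, rfl, hcc⟩ := exists_eq_five_mul ha h
      rw [Nat.cast_mul, Nat.cast_ofNat, mul_div_mul_left _ _ (by norm_num)]
      exact ih k (by omega) hc (by omega) hcc
    · refine ⟨n, ((Nat.Prime.coprime_iff_not_dvd (by norm_num)).2 h5).symm, ?_⟩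
      rwa [mul_div_cancel₀ a (by exact_mod_cast hn.ne')]

end GoldenField

/-! ### Elements with equal relative norms -/

-- Since `(a)(σ a, n) = (n)(a, n)`, the ideal `(a, n)` determines `(a)`.
theorem associated_of_span_pair_eq {R : Type*} [CommRing R] [IsDedekindDomain R] (σ : R →+* R)
    {a b n : R} (hn : n ≠ 0) (hσn : σ n = n) (ha : a * σ a = n ^ 2) (hb : b * σ b = n ^ 2)
    (h : Ideal.span {a, n} = Ideal.span {b, n}) : Associated a b := by
  have span_mul {x : R} (hx : x * σ x = n ^ 2) :
      Ideal.span {x} * Ideal.span {σ x, n} = Ideal.span {n} * Ideal.span {x, n} := by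
    simp only [Ideal.span_insert, Ideal.mul_sup, Ideal.span_singleton_mul_span_singleton, hx,
      pow_two, mul_comm x n]
    exact sup_comm _ _
  have map_span (x : R) : (Ideal.span {x, n}).map σ = Ideal.span {σ x, n} := by
    rw [Ideal.map_span, Set.image_pair, hσn]
  have hσ : Ideal.span {σ a, n} = Ideal.span {σ b, n} := by rw [← map_span, ← map_span, h]
  have h0 : Ideal.span {σ b, n} ≠ ⊥ := fun hbot =>
    hn (by simpa [hbot] using Ideal.subset_span (show n ∈ ({σ b, n} : Set R) by simp))
  refine Ideal.span_singleton_eq_span_singleton.1 (mul_right_cancel₀ h0 ?_)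
  rw [← hσ, span_mul ha, hσ, span_mul hb, h]

namespace GoldenField

theorem mem_span_pair_of_sqrtFive_mul_eq {a b : integers} {n : ℕ} (hn : 0 < n)
    (ha : (a : GoldenField) * star (a : GoldenField) = n ^ 2)
    (hab : ∃ x ∈ integers, ∃ y ∈ integers, sqrtFive * a = x * b + y * n) :
    a ∈ Ideal.span {b, (n : integers)} := by
  obtain ⟨m, hm, hr⟩ := div_natCast_mem_localIntegers a.2 hn ha
  obtain ⟨x, hx, y, hy, hxy⟩ := hab
  refine mem_of_coprime_nsmul_mem (Ideal.span {b, (n : integers)}).toAddSubgroup hm ?_ ?_ <;>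
    rw [Submodule.mem_toAddSubgroup, Ideal.mem_span_pair]
  · refine ⟨0, ⟨_, hr⟩, Subtype.ext ?_⟩
    have hn0 : (n : GoldenField) ≠ 0 := by exact_mod_cast hn.ne'
    push_cast [nsmul_eq_mul]
    field_simp
    ring
  · refine ⟨⟨sqrtFive, sqrtFive_mem_integers⟩ * ⟨x, hx⟩,
      ⟨sqrtFive, sqrtFive_mem_integers⟩ * ⟨y, hy⟩, Subtype.ext ?_⟩
    push_cast [nsmul_eq_mul]
    rw [show ((5 : integers) : GoldenField) = 5 from rfl]
    linear_combination -sqrtFive * hxy + (a : GoldenField) * sqrtFive_mul_sqrtFive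

theorem exists_unit_of_sqrtFive_mul_eq {a b : GoldenField} (ha : a ∈ integers)
    (hb : b ∈ integers) {n : ℕ} (hn : 0 < n) (han : a * star a = n ^ 2)
    (hbn : b * star b = n ^ 2)
    (hab : ∃ x ∈ integers, ∃ y ∈ integers, sqrtFive * a = x * b + y * n)
    (hba : ∃ x ∈ integers, ∃ y ∈ integers, sqrtFive * b = x * a + y * n) :
    ∃ ε : integersˣ, a = ((ε : integers) : GoldenField) * b := by
  lift a to integers using ha
  lift b to integers using hb
  have pair_le {x y : integers} (hx : x ∈ Ideal.span {y, (n : integers)}) :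
      Ideal.span {x, (n : integers)} ≤ Ideal.span {y, (n : integers)} :=
    Ideal.span_le.2 (Set.pair_subset hx (Ideal.subset_span (by simp)))
  obtain ⟨ε, hε⟩ := associated_of_span_pair_eq
    ((starRingEnd GoldenField).restrict integers integers fun _ => star_mem_integers)
    (n := (n : integers)) (by exact_mod_cast hn.ne') (map_natCast _ n)
    (Subtype.ext hbn) (Subtype.ext han)
    ((pair_le (mem_span_pair_of_sqrtFive_mul_eq hn hbn hba)).antisymm
      (pair_le (mem_span_pair_of_sqrtFive_mul_eq hn han hab)))
  exact ⟨ε, by rw [← hε]; push_cast; ring⟩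

theorem dvd_of_mul_star_eq_sq {a b e : GoldenField} {m n : ℕ} (he : e ∈ integers) (h : a = e * b)
    (ha : a * star a = (n : GoldenField) ^ 2) (hb : b * star b = (m : GoldenField) ^ 2) :
    m ∣ n := by
  obtain ⟨k, hk⟩ := norm_eq_intCast he
  have hke : e * star e = k := by rw [← ratCast_norm, hk, Rat.cast_intCast]
  have hnm : ((n ^ 2 : ℤ) : GoldenField) = ((m ^ 2 * k : ℤ) : GoldenField) := by
    push_cast
    rw [← ha, ← hb, ← hke, h, star_mul']
    ring
  have hdvd : (m : ℤ) ^ 2 ∣ (n : ℤ) ^ 2 := ⟨k, by exact_mod_cast hnm⟩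
  exact Int.natCast_dvd_natCast.1 ((Int.pow_dvd_pow_iff two_ne_zero).1 hdvd)

theorem eq_of_eq_unit_mul {a b : GoldenField} {m n : ℕ} (ε : integersˣ)
    (h : a = ((ε : integers) : GoldenField) * b) (ha : a * star a = (m : GoldenField) ^ 2)
    (hb : b * star b = (n : GoldenField) ^ 2) : m = n := by
  have hinv : b = ((ε⁻¹ : integersˣ) : integers) * a := by
    rw [h, ← mul_assoc, ← Subring.coe_mul, Units.inv_mul, Subring.coe_one, one_mul]
  exact Nat.dvd_antisymm (dvd_of_mul_star_eq_sq (Subtype.property _) hinv hb ha)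
    (dvd_of_mul_star_eq_sq (Subtype.property _) h ha hb)

end GoldenField

/-! ### The reduced trace -/

/-- The reduced trace `q ↦ q + q̄` of the quaternion algebra. -/
def reducedTrace : ℍ[GoldenField] →ₗ[GoldenField] GoldenField where
  toFun q := 2 * q.re
  map_add' p q := by rw [Quaternion.re_add, mul_add]
  map_smul' a q := by simp [mul_left_comm]

theorem reducedTrace_apply (q : ℍ[GoldenField]) : reducedTrace q = 2 * q.re := rfl

theorem self_add_star_eq_coe_reducedTrace (q : ℍ[GoldenField]) :
    q + star q = (reducedTrace q : ℍ[GoldenField]) :=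
  Quaternion.self_add_star' q

theorem reducedTrace_mem_integers {q : ℍ[GoldenField]} (hq : q ∈ icosians) :
    reducedTrace q ∈ integers := by
  rw [← coe_mem_icosians_iff, ← self_add_star_eq_coe_reducedTrace]
  exact add_mem hq (star_mem_icosians hq)

theorem reducedTrace_mul_comm (p q : ℍ[GoldenField]) :
    reducedTrace (p * q) = reducedTrace (q * p) := by
  simp only [reducedTrace_apply, Quaternion.re_mul]
  ring

theorem reducedTrace_star (q : ℍ[GoldenField]) : reducedTrace (star q) = reducedTrace q := by
  simp [reducedTrace_apply]

theorem reducedTrace_twist (q : ℍ[GoldenField]) :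
    reducedTrace (twist q) = star (reducedTrace q) := by
  simp [reducedTrace_apply, star_ofNat]

/-- The `𝔬`-basis of the icosian ring. -/
def icosianBasis : Fin 4 → ℍ[GoldenField] :=
  ![icosianOf 1 0 0 0, icosianOf 0 1 0 0, icosianOf 0 0 1 0, icosianOf 0 0 0 1]

/-- The basis dual to `icosianBasis` for the form `(x, y) ↦ trd(x ȳ)`. -/
def icosianDualBasis : Fin 4 → ℍ[GoldenField] :=
  ![icosianOf 2 (-1) (-tau) (2 * tau - 1), icosianOf (-1) 2 (tau - 1) (1 - 2 * tau),
    icosianOf (-tau) (tau - 1) 2 (-2), icosianOf (2 * tau - 1) (1 - 2 * tau) (-2) 4]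

theorem icosianBasis_mem_icosians (i : Fin 4) : icosianBasis i ∈ icosians := by
  fin_cases i <;> simp [icosianBasis, icosianOf_mem_icosians_iff, zero_mem, one_mem]

theorem icosianDualBasis_mem_icosians (i : Fin 4) : icosianDualBasis i ∈ icosians := by
  have h2 (n : ℕ) [n.AtLeastTwo] : (OfNat.ofNat n : GoldenField) ∈ integers := ofNat_mem _ n
  have hτ := tau_mem_integers
  have ho := one_mem integers
  fin_cases i <;>
    simp only [icosianDualBasis, Fin.zero_eta, Fin.mk_one, Fin.reduceFinMk, Matrix.cons_val,
      icosianOf_mem_icosians_iff] <;>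
    refine ⟨?_, ?_, ?_, ?_⟩ <;>
    first
      | exact h2 _ | exact neg_mem ‹_› | exact neg_mem (h2 _) | exact sub_mem hτ ho
      | exact sub_mem (mul_mem (h2 2) hτ) ho | exact sub_mem ho (mul_mem (h2 2) hτ)

theorem sum_reducedTrace_mul_star_icosianDualBasis_smul (x : ℍ[GoldenField]) :
    ∑ i, reducedTrace (x * star (icosianDualBasis i)) • icosianBasis i = x := by
  have h := tau_mul_tau
  rw [Fin.sum_univ_four]
  apply Quaternion.ext <;> simp [icosianBasis, icosianDualBasis, reducedTrace_apply] <;> grind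

-- The Casimir element of the trace form acts on `x` by the reduced trace.
theorem sum_icosianBasis_mul_mul_star_icosianDualBasis (x : ℍ[GoldenField]) :
    ∑ i, icosianBasis i * x * star (icosianDualBasis i) = (reducedTrace x : ℍ[GoldenField]) := by
  have h := tau_mul_tau
  rw [Fin.sum_univ_four]
  apply Quaternion.ext <;> simp [icosianBasis, icosianDualBasis, reducedTrace_apply] <;> grind

theorem mem_icosians_of_reducedTrace_mul_mem {x : ℍ[GoldenField]}
    (h : ∀ y ∈ icosians, reducedTrace (x * y) ∈ integers) : x ∈ icosians := by
  rw [← sum_reducedTrace_mul_star_icosianDualBasis_smul x]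
  exact sum_mem fun i _ => smul_mem_icosians
    (h _ (star_mem_icosians (icosianDualBasis_mem_icosians i))) (icosianBasis_mem_icosians i)

/-! ### Primitive icosians -/

theorem IsPrimitiveIcosian.exists_reducedTrace_mul_eq_one {q : ℍ[GoldenField]}
    (hq : IsPrimitiveIcosian q) : ∃ y ∈ icosians, reducedTrace (y * q) = 1 := by
  let I : AddSubgroup GoldenField := icosians.toAddSubgroup.map
    (reducedTrace.toAddMonoidHom.comp (AddMonoidHom.mulRight q))
  obtain ⟨α, ⟨y, hy, hyα⟩, hgen⟩ := isNormEuclidean_integers.exists_generator (I := I)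
    (by rintro _ ⟨y, hy, rfl⟩; exact reducedTrace_mem_integers (mul_mem_icosians hy hq.1))
    (by
      rintro _ ⟨y, hy, rfl⟩ z hz
      exact ⟨z • y, smul_mem_icosians hz hy, by simp [smul_mul_quaternion, mul_comm z]⟩)
  have mem_of_mul_mem (c : GoldenField) (hc : c * α ∈ integers) : c ∈ integers := by
    refine hq.2 c (mem_icosians_of_reducedTrace_mul_mem fun x hx => ?_)
    obtain ⟨z, hz, hxz⟩ := hgen _ ⟨x, hx, rfl⟩
    have hxz' : reducedTrace (q * x) = α * z := (reducedTrace_mul_comm q x).trans hxz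
    rw [smul_mul_quaternion, map_smul, smul_eq_mul, hxz', ← mul_assoc]
    exact mul_mem hc hz
  have hα : α ≠ 0 := by
    rintro rfl
    obtain ⟨k, hk⟩ := intCast_eq_of_ratCast_mem_integers (r := 1 / 2)
      (mem_of_mul_mem _ (by simp [zero_mem]))
    have h2k : ((2 * k : ℤ) : ℚ) = (1 : ℤ) := by push_cast; linarith
    have := Int.cast_injective h2k
    omega
  refine ⟨α⁻¹ • y, smul_mem_icosians
    (mem_of_mul_mem _ (by rw [inv_mul_cancel₀ hα]; exact one_mem _)) hy, ?_⟩
  have hyα' : reducedTrace (y * q) = α := hyα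
  rw [smul_mul_quaternion, map_smul, smul_eq_mul, hyα', inv_mul_cancel₀ hα]

theorem IsPrimitiveIcosian.isPrimitiveIcosian_twist {q : ℍ[GoldenField]}
    (hq : IsPrimitiveIcosian q) : IsPrimitiveIcosian (twist q) := by
  refine ⟨twist_mem_icosians hq.1, fun α h => ?_⟩
  have h' := twist_mem_icosians h
  rw [twist_smul, twist_twist] at h'
  simpa using star_mem_integers (hq.2 _ h')

theorem IsPrimitiveIcosian.one_mem_of_mul_mul_mem {q : ℍ[GoldenField]} (hq : IsPrimitiveIcosian q)
    (S : AddSubgroup ℍ[GoldenField]) (hS : ∀ x ∈ icosians, ∀ y ∈ icosians, x * q * y ∈ S) :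
    (1 : ℍ[GoldenField]) ∈ S := by
  obtain ⟨y, hy, h⟩ := hq.exists_reducedTrace_mul_eq_one
  rw [← Quaternion.coe_one, ← h, ← sum_icosianBasis_mul_mul_star_icosianDualBasis]
  refine sum_mem fun i _ => ?_
  rw [← mul_assoc]
  exact hS _ (mul_mem_icosians (icosianBasis_mem_icosians i) hy) _
    (star_mem_icosians (icosianDualBasis_mem_icosians i))

/-! ### Right ideals and greatest left common divisors -/

/-- The right ideal `p 𝕀 + c 𝕀` of the icosian ring. -/
def rightIdeal (p : ℍ[GoldenField]) (c : GoldenField) : AddSubgroup ℍ[GoldenField] :=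
  icosians.toAddSubgroup.map (AddMonoidHom.mulLeft p) ⊔
    icosians.toAddSubgroup.map (DistribSMul.toAddMonoidHom _ c)

theorem mem_rightIdeal {p z : ℍ[GoldenField]} {c : GoldenField} :
    z ∈ rightIdeal p c ↔ ∃ x ∈ icosians, ∃ y ∈ icosians, p * x + c • y = z := by
  simp [rightIdeal, AddSubgroup.mem_sup]

theorem mul_mem_rightIdeal_self (p : ℍ[GoldenField]) (c : GoldenField) {x : ℍ[GoldenField]}
    (hx : x ∈ icosians) : p * x ∈ rightIdeal p c :=
  mem_rightIdeal.2 ⟨x, hx, 0, zero_mem _, by rw [smul_zero, add_zero]⟩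

theorem smul_mem_rightIdeal (p : ℍ[GoldenField]) (c : GoldenField) {x : ℍ[GoldenField]}
    (hx : x ∈ icosians) : c • x ∈ rightIdeal p c :=
  mem_rightIdeal.2 ⟨0, zero_mem _, x, hx, by rw [mul_zero, zero_add]⟩

theorem self_mem_rightIdeal (p : ℍ[GoldenField]) (c : GoldenField) : p ∈ rightIdeal p c := by
  simpa using mul_mem_rightIdeal_self p c one_mem_icosians

theorem mul_mem_rightIdeal {p z w : ℍ[GoldenField]} {c : GoldenField} (hz : z ∈ rightIdeal p c)
    (hw : w ∈ icosians) : z * w ∈ rightIdeal p c := by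
  obtain ⟨x, hx, y, hy, rfl⟩ := mem_rightIdeal.1 hz
  rw [add_mul, mul_assoc, smul_mul_quaternion]
  exact add_mem (mul_mem_rightIdeal_self p c (mul_mem_icosians hx hw))
    (smul_mem_rightIdeal p c (mul_mem_icosians hy hw))

theorem mem_icosians_of_mem_rightIdeal {p z : ℍ[GoldenField]} {c : GoldenField}
    (hp : p ∈ icosians) (hc : c ∈ integers) (hz : z ∈ rightIdeal p c) : z ∈ icosians := by
  obtain ⟨x, hx, y, hy, rfl⟩ := mem_rightIdeal.1 hz
  exact add_mem (mul_mem_icosians hp hx) (smul_mem_icosians hc hy)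

theorem IcosianLeftDvd.of_mem_rightIdeal {d p z : ℍ[GoldenField]} {c : GoldenField}
    (hp : IcosianLeftDvd d p) (hc : IcosianLeftDvd d (c : ℍ[GoldenField]))
    (hz : z ∈ rightIdeal p c) : IcosianLeftDvd d z := by
  obtain ⟨a, ha, rfl⟩ := hp
  obtain ⟨b, hb, hc⟩ := hc
  obtain ⟨x, hx, y, hy, rfl⟩ := mem_rightIdeal.1 hz
  refine ⟨a * x + b * y, add_mem (mul_mem_icosians ha hx) (mul_mem_icosians hb hy), ?_⟩
  rw [← Quaternion.coe_mul_eq_smul, hc, mul_add, mul_assoc, mul_assoc]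

theorem exists_isIcosianGLCD_mem_rightIdeal {p : ℍ[GoldenField]} {c : GoldenField}
    (hp : p ∈ icosians) (hc : c ∈ integers) : ∃ g ∈ rightIdeal p c, IsIcosianGLCD g p c := by
  obtain ⟨g, hg, hgen⟩ := isNormEuclidean_icosianRing.exists_generator
    (I := rightIdeal p c) (fun z => mem_icosians_of_mem_rightIdeal hp hc)
    (fun z hz y => mul_mem_rightIdeal hz)
  refine ⟨g, hg, mem_icosians_of_mem_rightIdeal hp hc hg, hgen _ (self_mem_rightIdeal p c),
    hgen _ ?_, fun d _ hdp hdc => hdp.of_mem_rightIdeal hdc hg⟩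
  simpa [← Quaternion.coe_mul_eq_smul] using smul_mem_rightIdeal p c one_mem_icosians

theorem IsIcosianGLCD.mem_rightIdeal {g p : ℍ[GoldenField]} {c : GoldenField}
    (hg : IsIcosianGLCD g p c) (hp : p ∈ icosians) (hc : c ∈ integers) : g ∈ rightIdeal p c := by
  obtain ⟨g', hmem, hg'⟩ := exists_isIcosianGLCD_mem_rightIdeal hp hc
  obtain ⟨x, hx, rfl⟩ := hg.2.2.2 g' hg'.1 hg'.2.1 hg'.2.2.1
  exact mul_mem_rightIdeal hmem hx

theorem exists_isIcosianGLCD_iff {p q : ℍ[GoldenField]} {c : GoldenField} (hp : p ∈ icosians)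
    (hq : q ∈ icosians) (hc : c ∈ integers) :
    (∃ g, IsIcosianGLCD g p c ∧ IsIcosianGLCD g q c) ↔
      p ∈ rightIdeal q c ∧ q ∈ rightIdeal p c := by
  constructor
  · rintro ⟨g, hgp, hgq⟩
    obtain ⟨x, hx, hpx⟩ := hgp.2.1
    obtain ⟨y, hy, hqy⟩ := hgq.2.1
    exact ⟨hpx ▸ mul_mem_rightIdeal (hgq.mem_rightIdeal hq hc) hx,
      hqy ▸ mul_mem_rightIdeal (hgp.mem_rightIdeal hp hc) hy⟩
  · rintro ⟨hpq, hqp⟩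
    obtain ⟨g, -, hg⟩ := exists_isIcosianGLCD_mem_rightIdeal hp hc
    exact ⟨g, hg, hg.1, hg.2.1.of_mem_rightIdeal hg.2.2.1 hqp, hg.2.2.1, fun d hd hdq hdc =>
      hg.2.2.2 d hd (hdq.of_mem_rightIdeal hdc hpq) hdc⟩

/-! ### The twist modulo `√5` -/

theorem normSq_add (p q : ℍ[GoldenField]) :
    Quaternion.normSq (p + q) =
      Quaternion.normSq p + reducedTrace (p * star q) + Quaternion.normSq q := by
  simp only [Quaternion.normSq_def', reducedTrace_apply, Quaternion.re_add, Quaternion.imI_add,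
    Quaternion.imJ_add, Quaternion.imK_add, Quaternion.re_mul, Quaternion.re_star,
    Quaternion.imI_star, Quaternion.imJ_star, Quaternion.imK_star]
  ring

theorem inv_sqrtFive_smul_icosianOf_sub_star_mem {a b c d : GoldenField} (ha : a ∈ integers)
    (hb : b ∈ integers) (hc : c ∈ integers) (hd : d ∈ integers) :
    sqrtFive⁻¹ • (icosianOf a b c d - icosianOf (star a) (star b) (star c) (star d)) ∈
      icosians := by
  obtain ⟨i, hi⟩ := sub_star_eq_sqrtFive_mul ha
  obtain ⟨j, hj⟩ := sub_star_eq_sqrtFive_mul hb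
  obtain ⟨k, hk⟩ := sub_star_eq_sqrtFive_mul hc
  obtain ⟨l, hl⟩ := sub_star_eq_sqrtFive_mul hd
  rw [icosianOf_sub_icosianOf, hi, hj, hk, hl, ← smul_icosianOf,
    inv_smul_smul₀ sqrtFive_ne_zero]
  exact icosianOf_mem_icosians_iff.2
    ⟨intCast_mem _ i, intCast_mem _ j, intCast_mem _ k, intCast_mem _ l⟩

/-- An icosian negated by the twist; modulo `√5` it spans the differences `z - z̃` over `ℤ`. -/
def skewIcosian : ℍ[GoldenField] := icosianOf 0 0 (-1) 2

theorem skewIcosian_mem_icosians : skewIcosian ∈ icosians :=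
  icosianOf_mem_icosians_iff.2 ⟨zero_mem _, zero_mem _, neg_mem (one_mem _), ofNat_mem _ 2⟩

theorem normSq_skewIcosian : Quaternion.normSq skewIcosian = 3 := by
  have h := tau_mul_tau
  simp only [skewIcosian, Quaternion.normSq_def', re_icosianOf, imI_icosianOf, imJ_icosianOf,
    imK_icosianOf]
  grind

/-- The element `(z - z̃) / √5`; applied to `𝕀` it gives the dual of the lattice of icosians fixed
by the twist. -/
noncomputable def skewDual (z : ℍ[GoldenField]) : ℍ[GoldenField] := sqrtFive⁻¹ • (z - twist z)

theorem inv_sqrtFive_mul_tau_add_two : sqrtFive⁻¹ * (tau + 2) = tau := by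
  rw [inv_mul_eq_iff_eq_mul₀ sqrtFive_ne_zero, sqrtFive_eq]
  linear_combination -2 * tau_mul_tau

theorem exists_skewDual_sub_smul_skewIcosian_mem {z : ℍ[GoldenField]} (hz : z ∈ icosians) :
    ∃ k : ℤ, skewDual z - (sqrtFive⁻¹ * k) • skewIcosian ∈ icosians := by
  obtain ⟨a, b, c, ⟨_, m, n, rfl⟩, rfl⟩ := mem_icosians_iff.1 hz
  have hd : (m + n * tau : GoldenField) ∈ integers := ⟨m, n, rfl⟩
  refine ⟨m + 3 * n, ?_⟩
  have h := add_mem (inv_sqrtFive_smul_icosianOf_sub_star_mem a.2 b.2 c.2 hd)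
    (smul_mem_icosians (mul_mem (neg_mem (intCast_mem _ n)) tau_mem_integers)
      skewIcosian_mem_icosians)
  convert h using 1
  rw [skewDual, twist_icosianOf, skewIcosian, icosianOf_sub_icosianOf, icosianOf_sub_icosianOf,
    star_add_int_mul_tau, smul_icosianOf, smul_icosianOf, smul_icosianOf, icosianOf_sub_icosianOf]
  have := inv_sqrtFive_mul_tau_add_two
  apply Quaternion.ext <;> simp <;> grind

theorem skewIcosian_mul_icosianOf (a b c d : GoldenField) :
    skewIcosian * icosianOf a b (c + d) (-d) = star (icosianOf a b c d) * skewIcosian -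
      sqrtFive • (b • icosianOf 1 1 0 0 + c • icosianOf 0 0 1 0 + d • icosianOf 0 0 1 (-1)) := by
  rw [sqrtFive_eq, skewIcosian]
  apply Quaternion.ext <;> simp <;> grind

theorem inv_sqrtFive_smul_skewIcosian_mul_twist_sub_mem {q : ℍ[GoldenField]}
    (hq : q ∈ icosians) :
    sqrtFive⁻¹ • (skewIcosian * twist q - star q * skewIcosian) ∈ icosians := by
  obtain ⟨a, b, c, d, rfl⟩ := mem_icosians_iff.1 hq
  have hstar := mul_mem_icosians (star_mem_icosians
    (inv_sqrtFive_smul_icosianOf_sub_star_mem a.2 b.2 c.2 d.2)) skewIcosian_mem_icosians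
  rw [twist_icosianOf, skewIcosian_mul_icosianOf]
  have hz := zero_mem integers
  have ho := one_mem integers
  rw [Quaternion.star_smul, smul_mul_quaternion, star_sub, sub_mul] at hstar
  have hbcd : star (b : GoldenField) • icosianOf 1 1 0 0 + star (c : GoldenField) •
      icosianOf 0 0 1 0 + star (d : GoldenField) • icosianOf 0 0 1 (-1) ∈ icosians :=
    add_mem (add_mem
      (smul_mem_icosians (star_mem_integers b.2) (icosianOf_mem_icosians_iff.2 ⟨ho, ho, hz, hz⟩))
      (smul_mem_icosians (star_mem_integers c.2) (icosianOf_mem_icosians_iff.2 ⟨hz, hz, ho, hz⟩)))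
      (smul_mem_icosians (star_mem_integers d.2)
        (icosianOf_mem_icosians_iff.2 ⟨hz, hz, ho, neg_mem ho⟩))
  convert neg_mem (add_mem hstar hbcd) using 1
  rw [sub_right_comm, smul_sub, inv_smul_smul₀ sqrtFive_ne_zero, neg_add',
    ← neg_sub (star (icosianOf _ _ _ _) * _), smul_neg]

theorem skewDual_mem_icosians {z : ℍ[GoldenField]} (hz : z ∈ icosians)
    (h : sqrtFive⁻¹ * Quaternion.normSq (z - twist z) ∈ integers) : skewDual z ∈ icosians := by
  obtain ⟨k, hk⟩ := exists_skewDual_sub_smul_skewIcosian_mem hz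
  set w := skewDual z - (sqrtFive⁻¹ * k) • skewIcosian
  have hw : skewDual z = w + (sqrtFive⁻¹ * k) • skewIcosian := (sub_add_cancel _ _).symm
  have hnorm : sqrtFive⁻¹ * Quaternion.normSq (z - twist z) = sqrtFive * Quaternion.normSq w +
      k * reducedTrace (w * star skewIcosian) + sqrtFive⁻¹ * (3 * k ^ 2 : ℤ) := by
    have hsub : z - twist z = sqrtFive • skewDual z := (smul_inv_smul₀ sqrtFive_ne_zero _).symm
    rw [hsub, Quaternion.normSq_smul, hw, normSq_add, Quaternion.star_smul, mul_smul_quaternion,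
      map_smul, smul_eq_mul, Quaternion.normSq_smul, normSq_skewIcosian]
    push_cast
    field_simp [sqrtFive_ne_zero]
  have hdvd : (5 : ℤ) ∣ 3 * k ^ 2 := by
    refine five_dvd_of_sqrtFive_inv_mul_mem_integers ?_
    rw [eq_sub_of_add_eq' hnorm.symm]
    have hstar := star_mem_icosians skewIcosian_mem_icosians
    exact sub_mem h (add_mem (mul_mem sqrtFive_mem_integers (normSq_mem_integers hk))
      (mul_mem (intCast_mem _ k) (reducedTrace_mem_integers (mul_mem_icosians hk hstar))))
  obtain ⟨l, rfl⟩ : (5 : ℤ) ∣ k :=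
    Int.Prime.dvd_pow' (by norm_num) (IsCoprime.dvd_of_dvd_mul_left (by norm_num) hdvd)
  rw [hw]
  refine add_mem hk (smul_mem_icosians ?_ skewIcosian_mem_icosians)
  have hl : sqrtFive⁻¹ * ((5 * l : ℤ) : GoldenField) = sqrtFive * l := by
    rw [inv_mul_eq_iff_eq_mul₀ sqrtFive_ne_zero, ← mul_assoc, sqrtFive_mul_sqrtFive]
    push_cast
    rfl
  rw [hl]
  exact mul_mem sqrtFive_mem_integers (intCast_mem _ l)

theorem exists_mul_skewDual_mul_twist_eq {p z : ℍ[GoldenField]} (hp : p ∈ icosians)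
    (hz : z ∈ icosians) : ∃ x ∈ icosians, ∃ y ∈ icosians,
      p * skewDual z * twist p = p * x + (sqrtFive⁻¹ * Quaternion.normSq p) • y := by
  obtain ⟨k, hk⟩ := exists_skewDual_sub_smul_skewIcosian_mem hz
  have hv := inv_sqrtFive_smul_skewIcosian_mul_twist_sub_mem hp
  set w := skewDual z - (sqrtFive⁻¹ * k) • skewIcosian
  refine ⟨w * twist p + (k : GoldenField) • sqrtFive⁻¹ •
      (skewIcosian * twist p - star p * skewIcosian),
    add_mem (mul_mem_icosians hk (twist_mem_icosians hp)) (smul_mem_icosians (intCast_mem _ k) hv),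
    (k : GoldenField) • skewIcosian,
    smul_mem_icosians (intCast_mem _ k) skewIcosian_mem_icosians, ?_⟩
  have hN : p * (star p * skewIcosian) = Quaternion.normSq p • skewIcosian := by
    rw [← mul_assoc, Quaternion.self_mul_star, Quaternion.coe_mul_eq_smul]
  rw [show skewDual z = w + (sqrtFive⁻¹ * k) • skewIcosian from (sub_add_cancel _ _).symm,
    mul_add, add_mul, mul_add, mul_assoc p w, mul_smul_quaternion, mul_smul_quaternion,
    mul_smul_quaternion, mul_sub, hN, smul_mul_quaternion, mul_assoc p]
  module

theorem mul_skewDual_mul_twist_mem_rightIdeal {p z : ℍ[GoldenField]} {n : ℕ}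
    (hp : p ∈ icosians) (hn : 0 < n)
    (h : Quaternion.normSq p * star (Quaternion.normSq p) = (n : GoldenField) ^ 2)
    (hz : z ∈ icosians) : p * skewDual z * twist p ∈ rightIdeal p (n / sqrtFive) := by
  obtain ⟨x, hx, y, hy, hxy⟩ := exists_mul_skewDual_mul_twist_eq hp hz
  rw [hxy]
  refine add_mem (mul_mem_rightIdeal_self _ _ hx) ?_
  obtain ⟨m, hm, hmem⟩ := div_natCast_mem_localIntegers (normSq_mem_integers hp) hn h
  refine mem_of_coprime_nsmul_mem _ hm ?_ ?_
  · have hn' : (n : GoldenField) ≠ 0 := by exact_mod_cast hn.ne'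
    have : m • (sqrtFive⁻¹ * Quaternion.normSq p) • y = ((n : GoldenField) / sqrtFive) •
        ((m : GoldenField) * (Quaternion.normSq p / n)) • y := by
      rw [← Nat.cast_smul_eq_nsmul GoldenField, smul_smul, smul_smul]
      congr 1
      field_simp [sqrtFive_ne_zero]
    rw [this]
    exact smul_mem_rightIdeal _ _ (smul_mem_icosians hmem hy)
  · have : 5 • (sqrtFive⁻¹ * Quaternion.normSq p) • y = p * (sqrtFive • (star p * y)) := by
      rw [mul_smul_quaternion, ← mul_assoc, Quaternion.self_mul_star, Quaternion.coe_mul_eq_smul,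
        ← Nat.cast_smul_eq_nsmul GoldenField, smul_smul, smul_smul, Nat.cast_ofNat,
        ← sqrtFive_mul_sqrtFive, mul_assoc, mul_inv_cancel_left₀ sqrtFive_ne_zero]
    rw [this]
    exact mul_mem_rightIdeal_self _ _ (smul_mem_icosians sqrtFive_mem_integers
      (mul_mem_icosians (star_mem_icosians hp) hy))

/-! ### The lattice of coincidences and its dual -/

theorem dualSubmodule_dualSubmodule_of_isLattice {V : Type*} [AddCommGroup V] [Module ℚ V]
    {B : LinearMap.BilinForm ℚ V} (hB : B.Nondegenerate) (hs : B.IsSymm) (N : Submodule ℤ V)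
    [Submodule.IsLattice ℚ N] : B.dualSubmodule (B.dualSubmodule N) = N := by
  let b := Module.Free.chooseBasis ℤ N
  have hN : Submodule.span ℤ (Set.range (b.extendOfIsLattice ℚ)) = N := by
    have h := congrArg (Submodule.map N.subtype) b.span_eq
    rwa [Submodule.map_span, ← Set.range_comp, Submodule.map_top, Submodule.range_subtype,
      show N.subtype ∘ b = b.extendOfIsLattice ℚ from
        funext fun i => (Module.Basis.extendOfIsLattice_apply ℚ b i).symm] at h
  rw [← hN]
  exact B.dualSubmodule_dualSubmodule_of_basis hB hs _

theorem dualSubmodule_sup {V : Type*} [AddCommGroup V] [Module ℚ V] (B : LinearMap.BilinForm ℚ V)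
    (N N' : Submodule ℤ V) :
    B.dualSubmodule (N ⊔ N') = B.dualSubmodule N ⊓ B.dualSubmodule N' := by
  refine le_antisymm (fun x hx => ⟨fun y hy => hx y (Submodule.mem_sup_left hy),
    fun y hy => hx y (Submodule.mem_sup_right hy)⟩) ?_
  rintro x ⟨hx, hx'⟩ _ h
  obtain ⟨y, hy, y', hy', rfl⟩ := Submodule.mem_sup.1 h
  rw [map_add]
  exact add_mem (hx y hy) (hx' y' hy')

theorem dualSubmodule_map {V : Type*} [AddCommGroup V] [Module ℚ V] (B : LinearMap.BilinForm ℚ V)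
    {f g : V →ₗ[ℤ] V} (h : ∀ x y, B x (f y) = B (g x) y) (N : Submodule ℤ V) :
    B.dualSubmodule (N.map f) = (B.dualSubmodule N).comap g :=
  Submodule.ext fun x => by
    simp only [LinearMap.BilinForm.mem_dualSubmodule, Submodule.mem_map, Submodule.mem_comap,
      forall_exists_index, and_imp, forall_apply_eq_imp_iff₂, h]

namespace GoldenField

theorem exists_natCast_mul_mem_integers (x : GoldenField) :
    ∃ N : ℕ, 0 < N ∧ (N : GoldenField) * x ∈ integers := by
  have hx : x = (x.re : ℚ) + (x.im : ℚ) * sqrtFive := by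
    refine QuadraticAlgebra.ext ?_ ?_ <;> simp [sqrtFive]
  have hre := congrArg (Rat.cast : ℚ → GoldenField) x.re.den_mul_eq_num
  have him := congrArg (Rat.cast : ℚ → GoldenField) x.im.den_mul_eq_num
  rw [Rat.cast_mul, Rat.cast_natCast, Rat.cast_intCast] at hre him
  have h : ((x.re.den * x.im.den : ℕ) : GoldenField) * x =
      (x.im.den * x.re.num : ℤ) + (x.re.den * x.im.num : ℤ) * sqrtFive := by
    push_cast
    linear_combination (x.re.den * x.im.den : GoldenField) * hx + x.im.den * hre +
      x.re.den * sqrtFive * him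
  refine ⟨x.re.den * x.im.den, by positivity, ?_⟩
  rw [h]
  exact add_mem (intCast_mem _ _) (mul_mem (intCast_mem _ _) sqrtFive_mem_integers)

theorem mem_integers_of_sub_star {x : GoldenField} (hx : ∃ k : ℤ, x - star x = sqrtFive * k)
    (htau : ∃ k : ℤ, tau * x - star (tau * x) = sqrtFive * k) : x ∈ integers := by
  obtain ⟨k, hk⟩ := hx
  obtain ⟨l, hl⟩ := htau
  rw [star_mul', star_tau] at hl
  refine ⟨l - k, k, mul_left_cancel₀ sqrtFive_ne_zero ?_⟩
  push_cast
  linear_combination hl + (tau - 1) * hk + x * sqrtFive_eq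

theorem ratCast_re_of_star_eq_self {a : GoldenField} (ha : star a = a) :
    ((a.re : ℚ) : GoldenField) = a := by
  have him := congrArg QuadraticAlgebra.im ha
  refine QuadraticAlgebra.ext (by simp) ?_
  rw [QuadraticAlgebra.im_star] at him
  rw [QuadraticAlgebra.im_ratCast]
  linarith

end GoldenField

theorem reducedTrace_mul_star_comm (x y : ℍ[GoldenField]) :
    reducedTrace (x * star y) = reducedTrace (y * star x) := by
  rw [← reducedTrace_star, star_mul, star_star]

theorem reducedTrace_mul_star_twist (x y : ℍ[GoldenField]) :
    reducedTrace (x * star (twist y)) = star (reducedTrace (twist x * star y)) := by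
  rw [← reducedTrace_twist, twist_mul, twist_twist, twist_star, reducedTrace_mul_comm]

theorem reducedTrace_ratSmul_mul (r : ℚ) (x y : ℍ[GoldenField]) :
    reducedTrace (r • x * y) = r • reducedTrace (x * y) := by
  rw [← algebraMap_smul GoldenField r x, smul_mul_quaternion, map_smul, algebraMap_smul]

/-- The quaternions fixed by the twist. -/
def twistInvariants : Submodule ℚ ℍ[GoldenField] where
  carrier := {x | twist x = x}
  zero_mem' := by apply Quaternion.ext <;> simp
  add_mem' {x y} hx hy := by rw [Set.mem_ofPred_eq, twist_add, hx, hy]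
  smul_mem' r x hx := by
    rw [Set.mem_ofPred_eq, ← algebraMap_smul GoldenField, twist_smul, hx, eq_ratCast, star_ratCast]

/-- The rational vector space of quaternions fixed by the twist; as a type of its own it carries
an additive group structure from which all its module structures are built. -/
def TwistInvariant : Type := twistInvariants

namespace TwistInvariant

instance : AddCommGroup TwistInvariant := inferInstanceAs (AddCommGroup twistInvariants)

instance : Module ℚ TwistInvariant := inferInstanceAs (Module ℚ twistInvariants)

/-- The inclusion of the quaternions fixed by the twist into `ℍ(K)`, used as a coercion. -/
def toQuaternion : TwistInvariant →ₗ[ℚ] ℍ[GoldenField] := twistInvariants.subtype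

instance : CoeOut TwistInvariant ℍ[GoldenField] := ⟨toQuaternion⟩

theorem toQuaternion_injective : Function.Injective toQuaternion := Subtype.val_injective

theorem twist_toQuaternion (x : TwistInvariant) : twist x = x := x.2

end TwistInvariant

open TwistInvariant

/-- The symmetric bilinear form `(x, y) ↦ trd (x ȳ)`, which takes rational values on quaternions
fixed by the twist. -/
noncomputable def traceForm : LinearMap.BilinForm ℚ TwistInvariant :=
  LinearMap.mk₂ ℚ (fun x y => (reducedTrace (toQuaternion x * star (toQuaternion y))).re)
    (fun x x' y => by rw [map_add, add_mul, map_add, QuadraticAlgebra.re_add])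
    (fun r x y => by rw [map_smul, reducedTrace_ratSmul_mul, QuadraticAlgebra.re_smul])
    (fun x y y' => by
      rw [reducedTrace_mul_star_comm, map_add, add_mul, map_add, QuadraticAlgebra.re_add,
        reducedTrace_mul_star_comm, reducedTrace_mul_star_comm (toQuaternion y')])
    (fun r x y => by
      rw [reducedTrace_mul_star_comm, map_smul, reducedTrace_ratSmul_mul,
        QuadraticAlgebra.re_smul, reducedTrace_mul_star_comm])

theorem ratCast_traceForm (x y : TwistInvariant) :
    (traceForm x y : GoldenField) = reducedTrace (toQuaternion x * star (toQuaternion y)) :=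
  ratCast_re_of_star_eq_self <| by
    nth_rewrite 1 [← twist_toQuaternion x]
    rw [← reducedTrace_mul_star_twist, twist_toQuaternion]

theorem isSymm_traceForm : traceForm.IsSymm :=
  ⟨fun _ _ => congrArg QuadraticAlgebra.re (reducedTrace_mul_star_comm _ _)⟩

theorem nondegenerate_traceForm : traceForm.Nondegenerate := by
  suffices h : ∀ x, traceForm x x = 0 → x = 0 from
    ⟨fun x hx => h x (hx x), fun x hx => h x (hx x)⟩
  intro x hx
  have h := ratCast_traceForm x x
  rw [hx, Rat.cast_zero, Quaternion.self_mul_star, reducedTrace_apply, Quaternion.re_coe] at h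
  exact toQuaternion_injective (eq_zero_of_normSq_eq_zero (by simpa using h.symm))

theorem twist_skewDual (z : ℍ[GoldenField]) : twist (skewDual z) = skewDual z := by
  rw [skewDual, twist_smul, twist_sub, twist_twist, star_inv₀, star_sqrtFive, inv_neg]
  module

theorem skewDual_add (y z : ℍ[GoldenField]) : skewDual (y + z) = skewDual y + skewDual z := by
  rw [skewDual, twist_add, add_sub_add_comm, smul_add, skewDual, skewDual]

/-- The icosians fixed by the twist: the lattice `L`, in the form in which the coincidence problem
is solved. -/
def invariantIcosians : Submodule ℤ TwistInvariant :=
  (icosians.restrictScalars ℤ).comap (toQuaternion.restrictScalars ℤ)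

/-- The map `skewDual` with values in the quaternions fixed by the twist. -/
noncomputable def skewDualHom : ℍ[GoldenField] →+ TwistInvariant :=
  AddMonoidHom.mk' (fun z => ⟨skewDual z, twist_skewDual z⟩)
    fun y z => toQuaternion_injective (skewDual_add y z)

theorem toQuaternion_skewDualHom (z : ℍ[GoldenField]) :
    toQuaternion (skewDualHom z) = skewDual z := rfl

/-- The image of the icosians under `skewDual`. -/
noncomputable def invariantDual : Submodule ℤ TwistInvariant :=
  (icosians.restrictScalars ℤ).map skewDualHom.toIntLinearMap

theorem mem_invariantIcosians {x : TwistInvariant} :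
    x ∈ invariantIcosians ↔ (x : ℍ[GoldenField]) ∈ icosians := Iff.rfl

theorem mem_invariantDual {y : TwistInvariant} :
    y ∈ invariantDual ↔ ∃ z ∈ icosians, skewDualHom z = y := by
  simp [invariantDual]

instance : Module.Finite ℤ integers := by
  refine ⟨⟨{1, ⟨tau, tau_mem_integers⟩}, eq_top_iff.2 ?_⟩⟩
  rintro ⟨_, m, n, rfl⟩ -
  rw [Finset.coe_pair, Submodule.mem_span_pair]
  exact ⟨m, n, Subtype.ext (by simp)⟩

theorem fg_icosians : (icosians.restrictScalars ℤ).FG := by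
  have : Module.Finite integers icosians := Module.Finite.iff_fg.2 (Submodule.fg_span
    ((((Set.finite_singleton _).insert _).insert _).insert _))
  have h : Module.Finite ℤ icosians := Module.Finite.trans integers icosians
  exact Module.Finite.iff_fg.1 h

theorem exists_natCast_smul_mem_icosians (q : ℍ[GoldenField]) :
    ∃ N : ℕ, 0 < N ∧ (N : GoldenField) • q ∈ icosians := by
  choose N hN h using fun i =>
    exists_natCast_mul_mem_integers (reducedTrace (q * star (icosianDualBasis i)))
  refine ⟨∏ i, N i, Finset.prod_pos fun i _ => hN i, ?_⟩
  rw [← sum_reducedTrace_mul_star_icosianDualBasis_smul q, Finset.smul_sum]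
  refine sum_mem fun i _ => ?_
  obtain ⟨k, hk⟩ := Finset.dvd_prod_of_mem N (Finset.mem_univ i)
  rw [hk, smul_smul, Nat.cast_mul, mul_comm (N i : GoldenField), mul_assoc]
  exact smul_mem_icosians (mul_mem (natCast_mem _ k) (h i)) (icosianBasis_mem_icosians i)

theorem skewDual_sqrtFive_smul (z : ℍ[GoldenField]) :
    skewDual (sqrtFive • z) = z + twist z := by
  rw [skewDual, twist_smul, star_sqrtFive, inv_smul_eq_iff₀ sqrtFive_ne_zero]
  module

instance : Submodule.IsLattice ℚ invariantDual where
  fg := fg_icosians.map _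
  span_eq_top := by
    refine eq_top_iff.2 fun y _ => ?_
    obtain ⟨N, hN, hy⟩ := exists_natCast_smul_mem_icosians y
    have hmem : skewDualHom (sqrtFive • (N : GoldenField) • (y : ℍ[GoldenField])) ∈ invariantDual :=
      mem_invariantDual.2 ⟨_, smul_mem_icosians sqrtFive_mem_integers hy, rfl⟩
    have heq : (2 * N : ℚ)⁻¹ • skewDualHom (sqrtFive • (N : GoldenField) • (y : ℍ[GoldenField])) =
        y := by
      rw [inv_smul_eq_iff₀ (by positivity)]
      apply toQuaternion_injective
      rw [toQuaternion_skewDualHom, skewDual_sqrtFive_smul, twist_smul, twist_toQuaternion,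
        star_natCast, map_smul, ← algebraMap_smul GoldenField (2 * N : ℚ) (toQuaternion y),
        map_mul, map_natCast, map_ofNat, two_mul]
      exact (add_smul _ _ _).symm
    rw [← heq]
    exact Submodule.smul_mem _ _ (Submodule.subset_span hmem)

theorem twist_inv_natCast_smul_mul_mul_twist (p : ℍ[GoldenField]) (n : ℕ) {x : ℍ[GoldenField]}
    (hx : twist x = x) : twist ((n : GoldenField)⁻¹ • (p * x * twist p)) =
      (n : GoldenField)⁻¹ • (p * x * twist p) := by
  rw [twist_smul, star_inv₀, star_natCast, twist_mul, twist_mul, twist_twist, hx, mul_assoc]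

/-- The map `x ↦ p x p̃ / n` on the quaternions fixed by the twist. -/
noncomputable def twistConj (p : ℍ[GoldenField]) (n : ℕ) : TwistInvariant →ₗ[ℤ] TwistInvariant :=
  (AddMonoidHom.mk' (fun x => ⟨(n : GoldenField)⁻¹ • (p * x * twist p),
    twist_inv_natCast_smul_mul_mul_twist p n x.2⟩)
    fun x y => toQuaternion_injective <| by
      change (n : GoldenField)⁻¹ • (p * toQuaternion (x + y) * twist p) =
        (n : GoldenField)⁻¹ • (p * x * twist p) + (n : GoldenField)⁻¹ • (p * y * twist p)
      rw [map_add, mul_add, add_mul, smul_add]).toIntLinearMap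

theorem toQuaternion_twistConj (p : ℍ[GoldenField]) (n : ℕ) (x : TwistInvariant) :
    toQuaternion (twistConj p n x) = (n : GoldenField)⁻¹ • (p * x * twist p) := rfl

/-- The lattice `L ∩ p L p̃ / n` of coincidences, for `p p̃` of norm `n²`. -/
noncomputable def coincidenceLattice (p : ℍ[GoldenField]) (n : ℕ) : Submodule ℤ TwistInvariant :=
  invariantIcosians ⊓ invariantIcosians.comap (twistConj (star p) n)

/-- The dual of `coincidenceLattice p n` for `traceForm`. -/
noncomputable def dualLattice (p : ℍ[GoldenField]) (n : ℕ) : Submodule ℤ TwistInvariant :=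
  invariantDual ⊔ invariantDual.map (twistConj p n)

theorem traceForm_twistConj (p : ℍ[GoldenField]) (n : ℕ) (x y : TwistInvariant) :
    traceForm x (twistConj p n y) = traceForm (twistConj (star p) n x) y := by
  apply Rat.cast_injective (α := GoldenField)
  rw [ratCast_traceForm, ratCast_traceForm, toQuaternion_twistConj, toQuaternion_twistConj,
    Quaternion.star_smul, smul_mul_quaternion, mul_smul_quaternion, map_smul, map_smul, star_mul,
    star_mul, twist_star, ← mul_assoc, ← mul_assoc, reducedTrace_mul_comm]
  simp only [mul_assoc]

theorem traceForm_skewDualHom (x : TwistInvariant) (z : ℍ[GoldenField]) :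
    (traceForm x (skewDualHom z) : GoldenField) =
      sqrtFive⁻¹ * (reducedTrace (toQuaternion x * star z) -
        star (reducedTrace (toQuaternion x * star z))) := by
  rw [ratCast_traceForm, toQuaternion_skewDualHom, skewDual, Quaternion.star_smul, star_sub,
    mul_smul_quaternion, mul_sub, map_smul, map_sub, reducedTrace_mul_star_twist,
    twist_toQuaternion, smul_eq_mul]

theorem traceForm_skewDualHom_mem_one_iff {x : TwistInvariant} {z : ℍ[GoldenField]} :
    traceForm x (skewDualHom z) ∈ (1 : Submodule ℤ ℚ) ↔
      ∃ k : ℤ, reducedTrace (toQuaternion x * star z) -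
        star (reducedTrace (toQuaternion x * star z)) = sqrtFive * k := by
  simp only [Submodule.mem_one, ← Rat.cast_injective (α := GoldenField).eq_iff,
    traceForm_skewDualHom, eq_inv_mul_iff_mul_eq₀ sqrtFive_ne_zero, eq_comm, algebraMap_int_eq,
    eq_intCast, Rat.cast_intCast]

theorem dualSubmodule_invariantDual :
    traceForm.dualSubmodule invariantDual = invariantIcosians := by
  ext x
  rw [mem_invariantIcosians]
  constructor
  · intro hx
    have h : ∀ z ∈ icosians, ∃ k : ℤ, reducedTrace (toQuaternion x * star z) -
        star (reducedTrace (toQuaternion x * star z)) = sqrtFive * k := fun z hz =>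
      traceForm_skewDualHom_mem_one_iff.1 (hx _ (mem_invariantDual.2 ⟨z, hz, rfl⟩))
    refine mem_icosians_of_reducedTrace_mul_mem fun y hy => ?_
    have hy' := star_mem_icosians hy
    have htau := h (tau • star y) (smul_mem_icosians tau_mem_integers hy')
    rw [Quaternion.star_smul, star_star, mul_smul_quaternion, map_smul, smul_eq_mul] at htau
    exact mem_integers_of_sub_star (by simpa only [star_star] using h _ hy') htau
  · rintro hx y hy
    obtain ⟨z, hz, rfl⟩ := mem_invariantDual.1 hy
    exact traceForm_skewDualHom_mem_one_iff.2
      (sub_star_eq_sqrtFive_mul (reducedTrace_mem_integers (mul_mem_icosians hx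
        (star_mem_icosians hz))))

theorem dualSubmodule_dualLattice (p : ℍ[GoldenField]) (n : ℕ) :
    traceForm.dualSubmodule (dualLattice p n) = coincidenceLattice p n := by
  rw [dualLattice, dualSubmodule_sup, dualSubmodule_map _ (traceForm_twistConj p n),
    dualSubmodule_invariantDual, coincidenceLattice]

instance (p : ℍ[GoldenField]) (n : ℕ) : Submodule.IsLattice ℚ (dualLattice p n) :=
  .of_le_of_isLattice_of_fg ℚ (M := invariantDual) le_sup_left
    ((fg_icosians.map _).sup ((fg_icosians.map _).map _))

theorem dualLattice_le_dualLattice {p q : ℍ[GoldenField]} {m n : ℕ}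
    (h : coincidenceLattice q n ≤ coincidenceLattice p m) : dualLattice p m ≤ dualLattice q n := by
  have hdual := dualSubmodule_dualSubmodule_of_isLattice nondegenerate_traceForm isSymm_traceForm
  rw [← hdual (dualLattice p m), ← hdual (dualLattice q n), dualSubmodule_dualLattice,
    dualSubmodule_dualLattice]
  exact fun x hx y hy => hx y (h hy)

/-! ### Necessity of the two conditions -/

theorem smul_mem_rightIdeal_of_mem_dualLattice {p : ℍ[GoldenField]} (hp : p ∈ icosians) {n : ℕ}
    (hn : 0 < n) (h : Quaternion.normSq p * star (Quaternion.normSq p) = (n : GoldenField) ^ 2)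
    {y : TwistInvariant} (hy : y ∈ dualLattice p n) :
    (n : GoldenField) • (y : ℍ[GoldenField]) ∈ rightIdeal p (n / sqrtFive) := by
  have hn0 : (n : GoldenField) ≠ 0 := by exact_mod_cast hn.ne'
  obtain ⟨_, h₁, _, ⟨_, h₂, rfl⟩, rfl⟩ := Submodule.mem_sup.1 hy
  obtain ⟨z₁, hz₁, rfl⟩ := mem_invariantDual.1 h₁
  obtain ⟨z₂, hz₂, rfl⟩ := mem_invariantDual.1 h₂
  rw [map_add, smul_add, toQuaternion_twistConj, smul_inv_smul₀ hn0, toQuaternion_skewDualHom,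
    toQuaternion_skewDualHom, skewDual, smul_smul, ← div_eq_mul_inv]
  exact add_mem (smul_mem_rightIdeal _ _ (sub_mem hz₁ (twist_mem_icosians hz₁)))
    (mul_skewDual_mul_twist_mem_rightIdeal hp hn h hz₂)

theorem eq_skewDual_add_smul_skewDual (x : ℍ[GoldenField]) :
    x = skewDual ((tau - 1) • x) + tau • skewDual x := by
  have h : skewDual ((tau - 1) • x) + tau • skewDual x = sqrtFive⁻¹ • (2 * tau - 1) • x := by
    rw [skewDual, skewDual, twist_smul, star_sub, star_tau, star_one]
    module
  rw [h, ← sqrtFive_eq, inv_smul_smul₀ sqrtFive_ne_zero]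

theorem IsPrimitiveIcosian.inv_smul_mem_of_dualLattice_le {p : ℍ[GoldenField]}
    (hp : IsPrimitiveIcosian p) {n : ℕ} (S : AddSubgroup ℍ[GoldenField])
    (hS : ∀ z ∈ S, ∀ w ∈ icosians, z * w ∈ S)
    (h : ∀ y ∈ dualLattice p n, (y : ℍ[GoldenField]) ∈ S) :
    (n : GoldenField)⁻¹ • p ∈ S := by
  have hd : ∀ z ∈ icosians, ∀ w ∈ icosians,
      (n : GoldenField)⁻¹ • p * (skewDual z * twist p * w) ∈ S := by
    intro z hz w hw
    have hz' := h _ (Submodule.mem_sup_right (Submodule.mem_map_of_mem (f := twistConj p n)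
      (mem_invariantDual.2 ⟨z, hz, rfl⟩)))
    simpa only [toQuaternion_twistConj, toQuaternion_skewDualHom, smul_mul_quaternion, mul_assoc]
      using hS _ hz' w hw
  suffices h1 : (1 : ℍ[GoldenField]) ∈ S.comap (AddMonoidHom.mulLeft ((n : GoldenField)⁻¹ • p)) by
    simpa using h1
  refine hp.isPrimitiveIcosian_twist.one_mem_of_mul_mul_mem _ fun x hx y hy => ?_
  have hxy : x * twist p * y = skewDual ((tau - 1) • x) * twist p * y +
      skewDual x * twist p * (tau • y) := by
    conv_lhs => rw [eq_skewDual_add_smul_skewDual x]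
    rw [add_mul, add_mul, smul_mul_quaternion, smul_mul_quaternion, mul_smul_quaternion]
  rw [AddSubgroup.mem_comap, AddMonoidHom.coe_mulLeft, hxy, mul_add]
  exact add_mem (hd _ (smul_mem_icosians (sub_mem tau_mem_integers (one_mem _)) hx) _ hy)
    (hd _ hx _ (smul_mem_icosians tau_mem_integers hy))

theorem IsPrimitiveIcosian.smul_mem_rightIdeal_of_coincidenceLattice_le {p q : ℍ[GoldenField]}
    (hp : IsPrimitiveIcosian p) (hq : q ∈ icosians) {n m : ℕ} (hm : 0 < m)
    (h : Quaternion.normSq q * star (Quaternion.normSq q) = (m : GoldenField) ^ 2)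
    (hqp : coincidenceLattice q m ≤ coincidenceLattice p n) :
    ((m : GoldenField) / n) • p ∈ rightIdeal q (m / sqrtFive) := by
  have hmem := hp.inv_smul_mem_of_dualLattice_le (n := n)
    ((rightIdeal q (m / sqrtFive)).comap (DistribSMul.toAddMonoidHom _ (m : GoldenField)))
    (fun z hz w hw => by
      simpa only [AddSubgroup.mem_comap, DistribSMul.toAddMonoidHom_apply, smul_mul_quaternion]
        using mul_mem_rightIdeal hz hw)
    (fun y hy => smul_mem_rightIdeal_of_mem_dualLattice hq hm h (dualLattice_le_dualLattice hqp hy))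
  rwa [AddSubgroup.mem_comap, DistribSMul.toAddMonoidHom_apply, smul_smul, ← div_eq_mul_inv] at hmem

theorem dvd_of_sq_dvd_squarefree_mul_sq {d a b : ℕ} (hd : Squarefree d) (ha : 0 < a)
    (h : a ^ 2 ∣ d * b ^ 2) : a ∣ b := by
  obtain ⟨g, a', b', hg, hc, rfl, rfl⟩ := Nat.exists_coprime' (m := a) (n := b)
    (Nat.gcd_pos_of_pos_left b ha)
  have ha' : a' ^ 2 ∣ d := by
    rw [mul_pow, mul_pow, ← mul_assoc] at h
    exact (hc.pow 2 2).dvd_of_dvd_mul_right (Nat.dvd_of_mul_dvd_mul_right (by positivity) h)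
  rw [Nat.isUnit_iff.1 (hd a' (sq a' ▸ ha')), one_mul]
  exact dvd_mul_left _ _

theorem IsPrimitiveIcosian.dvd_of_smul_mem_rightIdeal {p q : ℍ[GoldenField]}
    (hp : IsPrimitiveIcosian p) (hq : q ∈ icosians) {n m : ℕ} (hn : 0 < n)
    (h : ((m : GoldenField) / n) • p ∈ rightIdeal q (m / sqrtFive)) : n ∣ m := by
  have hn0 : (n : GoldenField) ≠ 0 := by exact_mod_cast hn.ne'
  obtain ⟨x, hx, y, hy, hxy⟩ := mem_rightIdeal.1 h
  have hmem : (sqrtFive * ((m : GoldenField) / n)) • p ∈ icosians := by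
    rw [← smul_smul, ← hxy, smul_add, smul_smul, mul_div_cancel₀ _ sqrtFive_ne_zero]
    exact add_mem (smul_mem_icosians sqrtFive_mem_integers (mul_mem_icosians hq hx))
      (smul_mem_icosians (natCast_mem _ m) hy)
  obtain ⟨k, hk⟩ := norm_eq_intCast (hp.2 _ hmem)
  have hdvd : (5 * m ^ 2 : ℤ) = n ^ 2 * -k := by
    have hk' := ratCast_norm (sqrtFive * ((m : GoldenField) / n))
    rw [hk, star_mul', star_sqrtFive, star_div₀, star_natCast, star_natCast,
      Rat.cast_intCast] at hk'
    apply Int.cast_injective (α := GoldenField)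
    push_cast
    rw [hk', ← sqrtFive_mul_sqrtFive]
    field_simp
  refine dvd_of_sq_dvd_squarefree_mul_sq Nat.prime_five.squarefree hn ?_
  exact_mod_cast Dvd.intro _ hdvd.symm

theorem mem_rightIdeal_of_not_dvd {p q : ℍ[GoldenField]} (hp : p ∈ icosians)
    {n : ℕ} (hn : ¬ 5 ∣ n) (h : p ∈ rightIdeal q (n / sqrtFive)) : p ∈ rightIdeal q n := by
  have hcop : n.Coprime 5 := ((Nat.prime_five.coprime_iff_not_dvd).2 hn).symm
  refine mem_of_coprime_nsmul_mem _ hcop ?_ ?_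
  · rw [← Nat.cast_smul_eq_nsmul GoldenField]
    exact smul_mem_rightIdeal q n hp
  · obtain ⟨x, hx, y, hy, rfl⟩ := mem_rightIdeal.1 h
    have h5 : ((5 : ℕ) : GoldenField) * (n / sqrtFive) = n * sqrtFive := by
      rw [Nat.cast_ofNat, ← sqrtFive_mul_sqrtFive]
      field_simp [sqrtFive_ne_zero]
    rw [← Nat.cast_smul_eq_nsmul GoldenField, smul_add, ← mul_smul_quaternion, smul_smul, h5,
      mul_smul]
    exact mem_rightIdeal.2 ⟨_, smul_mem_icosians (natCast_mem _ 5) hx, _,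
      smul_mem_icosians sqrtFive_mem_integers hy, rfl⟩

/-- The divisor `c` of the coincidence problem in terms of `n = |p p̃|`: `√5` if `5 ∣ n`, and `1`
otherwise. -/
noncomputable def fiveDivisor (n : ℕ) : GoldenField := if 5 ∣ n then sqrtFive else 1

theorem fiveCorrection_eq_fiveDivisor {p : ℍ[GoldenField]} (hp : p ∈ icosians) {n : ℕ}
    (h : Quaternion.normSq p * star (Quaternion.normSq p) = (n : GoldenField) ^ 2) :
    fiveCorrection p = fiveDivisor n := by
  simp only [fiveCorrection, fiveDivisor, exists_eq_five_mul_iff (normSq_mem_integers hp) h]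

theorem natCast_five_mul_div_sqrtFive (k : ℕ) :
    ((5 * k : ℕ) : GoldenField) / sqrtFive = sqrtFive * k := by
  rw [Nat.cast_mul, Nat.cast_ofNat, ← sqrtFive_mul_sqrtFive, mul_assoc,
    mul_div_cancel_left₀ _ sqrtFive_ne_zero]

theorem natCast_div_fiveDivisor_mem_integers (n : ℕ) :
    (n : GoldenField) / fiveDivisor n ∈ integers := by
  unfold fiveDivisor
  split_ifs with h
  · obtain ⟨k, rfl⟩ := h
    rw [natCast_five_mul_div_sqrtFive]
    exact mul_mem sqrtFive_mem_integers (natCast_mem _ k)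
  · rw [div_one]
    exact natCast_mem _ n

theorem IsPrimitiveIcosian.mem_rightIdeal_of_coincidenceLattice_le {p q : ℍ[GoldenField]}
    (hp : IsPrimitiveIcosian p) (hq : q ∈ icosians) {n : ℕ} (hn : 0 < n)
    (h : Quaternion.normSq q * star (Quaternion.normSq q) = (n : GoldenField) ^ 2)
    (hqp : coincidenceLattice q n ≤ coincidenceLattice p n) :
    p ∈ rightIdeal q (n / fiveDivisor n) := by
  have hmem := hp.smul_mem_rightIdeal_of_coincidenceLattice_le hq hn h hqp
  rw [div_self (by exact_mod_cast hn.ne'), one_smul] at hmem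
  unfold fiveDivisor
  split_ifs with h5
  · exact hmem
  · rw [div_one]
    exact mem_rightIdeal_of_not_dvd hp.1 h5 hmem

theorem exists_normSq_eq_of_mem_rightIdeal {p q : ℍ[GoldenField]} (hq : q ∈ icosians)
    {c : GoldenField} (hc : c ∈ integers) (h : p ∈ rightIdeal q c) :
    ∃ a ∈ integers, ∃ b ∈ integers,
      Quaternion.normSq p = a * Quaternion.normSq q + b * c := by
  obtain ⟨x, hx, y, hy, rfl⟩ := mem_rightIdeal.1 h
  refine ⟨Quaternion.normSq x, normSq_mem_integers hx,
    reducedTrace (q * x * star y) + c * Quaternion.normSq y,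
    add_mem (reducedTrace_mem_integers (mul_mem_icosians (mul_mem_icosians hq hx)
      (star_mem_icosians hy))) (mul_mem hc (normSq_mem_integers hy)), ?_⟩
  rw [normSq_add, Quaternion.normSq_smul, map_mul, Quaternion.star_smul, mul_smul_quaternion,
    map_smul, smul_eq_mul]
  ring

theorem exists_sqrtFive_mul_normSq_eq {p q : ℍ[GoldenField]} (hq : q ∈ icosians) {n : ℕ}
    (h : p ∈ rightIdeal q (n / fiveDivisor n)) : ∃ a ∈ integers, ∃ b ∈ integers,
      sqrtFive * Quaternion.normSq p = a * Quaternion.normSq q + b * n := by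
  obtain ⟨a, ha, b, hb, hab⟩ := exists_normSq_eq_of_mem_rightIdeal hq
    (natCast_div_fiveDivisor_mem_integers n) h
  have h5 : sqrtFive / fiveDivisor n ∈ integers := by
    unfold fiveDivisor
    split_ifs
    · rw [div_self sqrtFive_ne_zero]
      exact one_mem _
    · rw [div_one]
      exact sqrtFive_mem_integers
  refine ⟨sqrtFive * a, mul_mem sqrtFive_mem_integers ha, sqrtFive / fiveDivisor n * b,
    mul_mem h5 hb, ?_⟩
  rw [hab]
  ring

theorem exists_unit_of_mem_rightIdeal {p q : ℍ[GoldenField]} (hp : p ∈ icosians)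
    (hq : q ∈ icosians) {n : ℕ} (hn : 0 < n)
    (h₁ : Quaternion.normSq p * star (Quaternion.normSq p) = (n : GoldenField) ^ 2)
    (h₂ : Quaternion.normSq q * star (Quaternion.normSq q) = (n : GoldenField) ^ 2)
    (hpq : p ∈ rightIdeal q (n / fiveDivisor n)) (hqp : q ∈ rightIdeal p (n / fiveDivisor n)) :
    ∃ ε : integersˣ, Quaternion.normSq p = ((ε : integers) : GoldenField) * Quaternion.normSq q :=
  exists_unit_of_sqrtFive_mul_eq (normSq_mem_integers hp) (normSq_mem_integers hq) hn h₁ h₂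
    (exists_sqrtFive_mul_normSq_eq hq hpq) (exists_sqrtFive_mul_normSq_eq hp hqp)

/-! ### Sufficiency of the two conditions -/

theorem mem_coincidenceLattice {p : ℍ[GoldenField]} {n : ℕ} {x : TwistInvariant} :
    x ∈ coincidenceLattice p n ↔ (x : ℍ[GoldenField]) ∈ icosians ∧
      (n : GoldenField)⁻¹ • (star p * x * twist (star p)) ∈ icosians := Iff.rfl

theorem add_smul_mul_mul_twist_add_smul (a b : ℍ[GoldenField]) (c : GoldenField)
    {x : ℍ[GoldenField]} (hx : twist x = x) :
    (b + c • a) * x * twist (b + c • a) =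
      b * x * twist b + (c • (a * x * twist b) + star c • twist (a * x * twist b)) +
        (c * star c) • (a * x * twist a) := by
  simp only [twist_add, twist_smul, twist_mul, twist_twist, hx, add_mul, mul_add,
    smul_mul_quaternion, mul_smul_quaternion, mul_assoc]
  module

theorem normSq_sub_twist (z : ℍ[GoldenField]) :
    Quaternion.normSq (z - twist z) =
      Quaternion.normSq z + star (Quaternion.normSq z) - reducedTrace (z * star (twist z)) := by
  have hneg : z * star (-twist z) = -(z * star (twist z)) := by
    refine .trans ?_ (mul_neg z _)
    congr 1
    ext <;> simp
  rw [sub_eq_add_neg, normSq_add, hneg, map_neg, Quaternion.normSq_neg, normSq_twist]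
  ring

theorem star_mul_add_smul (p s t : ℍ[GoldenField]) (c : GoldenField) :
    star (p * s + c • t) = star s * star p + c • star t := by
  ext <;> simp <;> ring

-- The cross term is rotated to `trd (b̄ a x b̃ ã* x̄)`, where `b̄ a = trd (b ā) - ā b`.
theorem inv_sqrtFive_mul_reducedTrace_mul_star_twist_mem {a b x : ℍ[GoldenField]}
    (ha : a ∈ icosians) (hb : b ∈ icosians) (hx : x ∈ icosians) (hxt : twist x = x)
    (hbx : sqrtFive⁻¹ • (b * x * twist b) ∈ icosians)
    (hab : sqrtFive⁻¹ * reducedTrace (b * star a) ∈ integers) :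
    sqrtFive⁻¹ * reducedTrace (a * x * twist b * star (twist (a * x * twist b))) ∈ integers := by
  have hba : star b * a = (reducedTrace (b * star a) : ℍ[GoldenField]) - star a * b := by
    rw [reducedTrace_mul_comm, ← self_add_star_eq_coe_reducedTrace, star_mul, star_star,
      add_sub_cancel_left]
  have h : reducedTrace (a * x * twist b * star (twist (a * x * twist b))) =
      reducedTrace (b * star a) * reducedTrace (x * twist b * star (twist a) * star x) -
        reducedTrace (star a * (b * x * twist b) * star (twist a) * star x) := by
    have hrot : star b * (a * x * twist b * (star (twist a) * star x)) =
        star b * a * (x * twist b * star (twist a) * star x) := by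
      simp only [mul_assoc]
    rw [twist_mul, twist_mul, twist_twist, hxt, star_mul, star_mul,
      ← mul_assoc (a * x * twist b), reducedTrace_mul_comm, hrot, hba, sub_mul, map_sub,
      Quaternion.coe_mul_eq_smul, map_smul, smul_eq_mul]
    simp only [mul_assoc]
  have hy : star (twist a) * star x ∈ icosians :=
    mul_mem_icosians (star_mem_icosians (twist_mem_icosians ha)) (star_mem_icosians hx)
  rw [h, mul_sub, ← mul_assoc, ← smul_eq_mul sqrtFive⁻¹ (reducedTrace (star a * _ * _ * _)),
    ← map_smul]
  refine sub_mem (mul_mem hab (reducedTrace_mem_integers ?_)) (reducedTrace_mem_integers ?_)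
  · rw [mul_assoc]
    exact mul_mem_icosians (mul_mem_icosians hx (twist_mem_icosians hb)) hy
  · rw [mul_assoc, ← smul_mul_quaternion, ← mul_smul_quaternion]
    exact mul_mem_icosians (mul_mem_icosians (star_mem_icosians ha) hbx) hy

theorem skewDual_mul_mul_twist_mem_icosians {a b x : ℍ[GoldenField]}
    (ha : a ∈ icosians) (hb : b ∈ icosians) (hx : x ∈ icosians) (hxt : twist x = x)
    (hbx : sqrtFive⁻¹ • (b * x * twist b) ∈ icosians)
    (hab : sqrtFive⁻¹ * reducedTrace (b * star a) ∈ integers)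
    (hbb : sqrtFive⁻¹ * Quaternion.normSq b ∈ integers) :
    skewDual (a * x * twist b) ∈ icosians := by
  refine skewDual_mem_icosians
    (mul_mem_icosians (mul_mem_icosians ha hx) (twist_mem_icosians hb)) ?_
  have hbb' : sqrtFive⁻¹ * star (Quaternion.normSq b) ∈ integers := by
    simpa [star_sqrtFive] using star_mem_integers hbb
  rw [normSq_sub_twist, mul_sub, mul_add]
  refine sub_mem (add_mem ?_ ?_)
    (inv_sqrtFive_mul_reducedTrace_mul_star_twist_mem ha hb hx hxt hbx hab)
  · rw [map_mul, normSq_twist, mul_left_comm]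
    exact mul_mem (normSq_mem_integers (mul_mem_icosians ha hx)) hbb'
  · rw [map_mul, normSq_twist, star_mul', star_star, mul_left_comm]
    exact mul_mem (star_mem_integers (normSq_mem_integers (mul_mem_icosians ha hx))) hbb

theorem inv_sqrtFive_mul_reducedTrace_mem_integers {p s t : ℍ[GoldenField]} (hp : p ∈ icosians)
    (hs : s ∈ icosians) (ht : t ∈ icosians) {k : ℕ} (hk : 0 < k)
    (h₁ : Quaternion.normSq p * star (Quaternion.normSq p) = ((5 * k : ℕ) : GoldenField) ^ 2)
    (h₂ : Quaternion.normSq (p * s + (sqrtFive * k) • t) *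
      star (Quaternion.normSq (p * s + (sqrtFive * k) • t)) = ((5 * k : ℕ) : GoldenField) ^ 2) :
    sqrtFive⁻¹ * reducedTrace (star s * star p * t) ∈ integers := by
  have hpst := mul_mem_icosians (mul_mem_icosians (star_mem_icosians hs) (star_mem_icosians hp)) ht
  have hq : p * s + (sqrtFive * k) • t ∈ icosians := add_mem (mul_mem_icosians hp hs)
    (smul_mem_icosians (mul_mem sqrtFive_mem_integers (natCast_mem _ k)) ht)
  have h5k : 0 < 5 * k := by positivity
  have hk0 : (k : GoldenField) ≠ 0 := by exact_mod_cast hk.ne'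
  have h5 : (5 : GoldenField) = sqrtFive * sqrtFive := sqrtFive_mul_sqrtFive.symm
  have hnorm : sqrtFive⁻¹ * reducedTrace (star s * star p * t) =
      Quaternion.normSq (p * s + (sqrtFive * k) • t) / (5 * k : ℕ) -
        Quaternion.normSq p / (5 * k : ℕ) * Quaternion.normSq s - k * Quaternion.normSq t := by
    have htr : reducedTrace (p * s * star t) = reducedTrace (star s * star p * t) := by
      rw [reducedTrace_mul_star_comm, star_mul, reducedTrace_mul_comm]
    rw [normSq_add, map_mul Quaternion.normSq p, Quaternion.normSq_smul, Quaternion.star_smul,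
      mul_smul_quaternion, map_smul, smul_eq_mul, htr]
    have := sqrtFive_ne_zero
    push_cast
    rw [h5]
    field_simp
    ring
  refine mem_integers_of_mem_localIntegers ?_ ?_
  · rw [hnorm]
    refine sub_mem (sub_mem (div_natCast_mem_localIntegers (normSq_mem_integers hq) h5k h₂)
      (mul_mem (div_natCast_mem_localIntegers (normSq_mem_integers hp) h5k h₁)
        (integers_le_localIntegers (normSq_mem_integers hs)))) (integers_le_localIntegers
          (mul_mem (natCast_mem _ k) (normSq_mem_integers ht)))
  · rw [h5, mul_assoc, mul_inv_cancel_left₀ sqrtFive_ne_zero]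
    exact mul_mem sqrtFive_mem_integers (reducedTrace_mem_integers hpst)

theorem inv_smul_star_mul_mul_twist_mem_icosians {p s : ℍ[GoldenField]} (hs : s ∈ icosians)
    {n : ℕ} {x : TwistInvariant} (hx : x ∈ coincidenceLattice p n) :
    (n : GoldenField)⁻¹ • (star s * star p * x * twist (star s * star p)) ∈ icosians := by
  have h := mul_mem_icosians
    (mul_mem_icosians (star_mem_icosians hs) (mem_coincidenceLattice.1 hx).2)
    (twist_mem_icosians (star_mem_icosians hs))
  rw [twist_mul]
  rwa [mul_smul_quaternion, smul_mul_quaternion, mul_assoc, mul_assoc (star p * _), ← mul_assoc,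
    ← mul_assoc (star s)] at h

theorem coincidenceLattice_le_of_mem_rightIdeal_natCast {p q : ℍ[GoldenField]} (hp : p ∈ icosians)
    {n : ℕ} (hn : 0 < n) (h : q ∈ rightIdeal p n) :
    coincidenceLattice p n ≤ coincidenceLattice q n := by
  obtain ⟨s, hs, t, ht, rfl⟩ := mem_rightIdeal.1 h
  intro x hx
  obtain ⟨hxi, -⟩ := mem_coincidenceLattice.1 hx
  have hn0 : (n : GoldenField) ≠ 0 := by exact_mod_cast hn.ne'
  refine mem_coincidenceLattice.2 ⟨hxi, ?_⟩
  have hb := mul_mem_icosians (star_mem_icosians hs) (star_mem_icosians hp)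
  have ht' := star_mem_icosians ht
  have hz := mul_mem_icosians (mul_mem_icosians ht' hxi) (twist_mem_icosians hb)
  have hcancel (y z w : ℍ[GoldenField]) : (n : GoldenField)⁻¹ • (y + ((n : GoldenField) • z +
      (n : GoldenField) • twist z) + ((n : GoldenField) * n) • w) =
      (n : GoldenField)⁻¹ • y + (z + twist z) + (n : GoldenField) • w := by
    match_scalars <;> field_simp
  rw [star_mul_add_smul, add_smul_mul_mul_twist_add_smul _ _ _ (twist_toQuaternion x),
    star_natCast, hcancel]
  exact add_mem (add_mem (inv_smul_star_mul_mul_twist_mem_icosians hs hx)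
    (add_mem hz (twist_mem_icosians hz))) (smul_mem_icosians (natCast_mem _ n)
      (mul_mem_icosians (mul_mem_icosians ht' hxi) (twist_mem_icosians ht')))

theorem inv_smul_add_sqrtFive_smul_mul_mul_twist (a b : ℍ[GoldenField]) {k : ℕ} (hk : 0 < k)
    {x : ℍ[GoldenField]} (hx : twist x = x) :
    ((5 * k : ℕ) : GoldenField)⁻¹ •
        ((b + (sqrtFive * k) • a) * x * twist (b + (sqrtFive * k) • a)) =
      ((5 * k : ℕ) : GoldenField)⁻¹ • (b * x * twist b) + skewDual (a * x * twist b) -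
        (k : GoldenField) • (a * x * twist a) := by
  have hk0 : (k : GoldenField) ≠ 0 := by exact_mod_cast hk.ne'
  have h0 := sqrtFive_ne_zero
  rw [add_smul_mul_mul_twist_add_smul _ _ _ hx, star_mul', star_sqrtFive, star_natCast, skewDual,
    Nat.cast_mul, Nat.cast_ofNat, ← sqrtFive_mul_sqrtFive]
  match_scalars <;> field_simp

theorem coincidenceLattice_le_of_mem_rightIdeal_sqrtFive_mul {p q : ℍ[GoldenField]}
    (hp : p ∈ icosians) {k : ℕ} (hk : 0 < k)
    (h₁ : Quaternion.normSq p * star (Quaternion.normSq p) = ((5 * k : ℕ) : GoldenField) ^ 2)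
    (h₂ : Quaternion.normSq q * star (Quaternion.normSq q) = ((5 * k : ℕ) : GoldenField) ^ 2)
    (h : q ∈ rightIdeal p (sqrtFive * k)) :
    coincidenceLattice p (5 * k) ≤ coincidenceLattice q (5 * k) := by
  obtain ⟨s, hs, t, ht, rfl⟩ := mem_rightIdeal.1 h
  intro x hx
  obtain ⟨hxi, -⟩ := mem_coincidenceLattice.1 hx
  have hk0 : (k : GoldenField) ≠ 0 := by exact_mod_cast hk.ne'
  have h0 := sqrtFive_ne_zero
  have hn : ((5 * k : ℕ) : GoldenField) = sqrtFive * (sqrtFive * k) := by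
    rw [← mul_assoc, sqrtFive_mul_sqrtFive, Nat.cast_mul, Nat.cast_ofNat]
  have hb := mul_mem_icosians (star_mem_icosians hs) (star_mem_icosians hp)
  have ht' := star_mem_icosians ht
  have hbx := inv_smul_star_mul_mul_twist_mem_icosians hs hx
  have hskew : skewDual (star t * x * twist (star s * star p)) ∈ icosians := by
    refine skewDual_mul_mul_twist_mem_icosians ht' hb hxi (twist_toQuaternion x) ?_ ?_ ?_
    · have h' := smul_mem_icosians (mul_mem sqrtFive_mem_integers (natCast_mem _ k)) hbx
      rwa [smul_smul, hn, mul_inv, mul_left_comm, mul_inv_cancel₀ (mul_ne_zero h0 hk0), mul_one]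
        at h'
    · rw [star_star]
      exact inv_sqrtFive_mul_reducedTrace_mem_integers hp hs ht hk h₁ h₂
    · rw [map_mul, Quaternion.normSq_star, Quaternion.normSq_star, mul_left_comm]
      exact mul_mem (normSq_mem_integers hs) (sqrtFive_inv_mul_mem_integers
        (normSq_mem_integers hp) (k := 5 * k ^ 2) (by rw [h₁]; push_cast; ring))
  refine mem_coincidenceLattice.2 ⟨hxi, ?_⟩
  rw [star_mul_add_smul,
    inv_smul_add_sqrtFive_smul_mul_mul_twist _ _ hk (twist_toQuaternion x)]
  exact sub_mem (add_mem hbx hskew) (smul_mem_icosians (natCast_mem _ k)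
    (mul_mem_icosians (mul_mem_icosians ht' hxi) (twist_mem_icosians ht')))

theorem coincidenceLattice_le_of_mem_rightIdeal {p q : ℍ[GoldenField]} (hp : p ∈ icosians) {n : ℕ}
    (hn : 0 < n)
    (h₁ : Quaternion.normSq p * star (Quaternion.normSq p) = (n : GoldenField) ^ 2)
    (h₂ : Quaternion.normSq q * star (Quaternion.normSq q) = (n : GoldenField) ^ 2)
    (h : q ∈ rightIdeal p (n / fiveDivisor n)) :
    coincidenceLattice p n ≤ coincidenceLattice q n := by
  unfold fiveDivisor at h
  split_ifs at h with h5
  · obtain ⟨k, rfl⟩ := h5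
    rw [natCast_five_mul_div_sqrtFive] at h
    exact coincidenceLattice_le_of_mem_rightIdeal_sqrtFive_mul hp (by omega) h₁ h₂ h
  · rw [div_one] at h
    exact coincidenceLattice_le_of_mem_rightIdeal_natCast hp hn h

/-! ### The real embedding -/

theorem toReal_tau : toReal tau = Real.goldenRatio := by
  change (1 / 2 : ℚ) • (1 : ℝ) + (1 / 2 : ℚ) • √5 = Real.goldenRatio
  rw [Rat.smul_def, Rat.smul_def, Real.goldenRatio]
  push_cast
  ring

@[simp] theorem re_quatToReal (q : ℍ[GoldenField]) : (quatToReal q).re = toReal q.re := rfl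

@[simp] theorem imI_quatToReal (q : ℍ[GoldenField]) : (quatToReal q).imI = toReal q.imI := rfl

@[simp] theorem imJ_quatToReal (q : ℍ[GoldenField]) : (quatToReal q).imJ = toReal q.imJ := rfl

@[simp] theorem imK_quatToReal (q : ℍ[GoldenField]) : (quatToReal q).imK = toReal q.imK := rfl

theorem quatToReal_add (p q : ℍ[GoldenField]) :
    quatToReal (p + q) = quatToReal p + quatToReal q := by
  apply Quaternion.ext <;> simp

theorem quatToReal_mul (p q : ℍ[GoldenField]) :
    quatToReal (p * q) = quatToReal p * quatToReal q := by
  apply Quaternion.ext <;> simp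

theorem quatToReal_smul (a : GoldenField) (q : ℍ[GoldenField]) :
    quatToReal (a • q) = toReal a • quatToReal q := by
  apply Quaternion.ext <;> simp

theorem quatToReal_injective : Function.Injective quatToReal := by
  intro p q h
  obtain ⟨hR, hI, hJ, hK⟩ := Quaternion.ext_iff.1 h
  apply Quaternion.ext <;> apply toReal_injective <;> assumption

theorem normSq_mul_star_of_twistLength {p : ℍ[GoldenField]} {n : ℕ} (h : twistLength p = n) :
    Quaternion.normSq p * star (Quaternion.normSq p) = (n : GoldenField) ^ 2 := by
  apply toReal_injective
  rw [← normSq_twist, ← map_mul Quaternion.normSq, map_pow, map_natCast, ← h, twistLength, pow_two,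
    ← Quaternion.normSq_eq_norm_mul_self, toReal_normSq, Quaternion.normSq_def']
  rfl

theorem IsPrimitiveIcosian.twistLength_pos {p : ℍ[GoldenField]} (hp : IsPrimitiveIcosian p) {n : ℕ}
    (h : twistLength p = n) : 0 < n := by
  refine Nat.pos_of_ne_zero ?_
  rintro rfl
  have h0 : Quaternion.normSq p = 0 := by simpa using normSq_mul_star_of_twistLength h
  obtain ⟨y, -, hy⟩ := hp.exists_reducedTrace_mul_eq_one
  rw [eq_zero_of_normSq_eq_zero h0, mul_zero, map_zero] at hy
  exact zero_ne_one hy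

/-- The inclusion of the quaternions fixed by the twist into `ℍ(ℝ)`. -/
noncomputable def realEmbedding : TwistInvariant →ₗ[ℤ] ℍ[ℝ] :=
  (AddMonoidHom.mk' (fun x : TwistInvariant => quatToReal x)
    fun x y => by rw [map_add, quatToReal_add]).toIntLinearMap

theorem realEmbedding_apply (x : TwistInvariant) : realEmbedding x = quatToReal x := rfl

theorem realEmbedding_injective : Function.Injective realEmbedding :=
  quatToReal_injective.comp toQuaternion_injective

/-! ### The lattice `L` -/

theorem eq_intCast_of_star_eq_self {a : GoldenField} (ha : a ∈ integers) (h : star a = a) :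
    ∃ k : ℤ, a = k := by
  obtain ⟨k, hk⟩ := intCast_eq_of_ratCast_mem_integers (ratCast_re_of_star_eq_self h ▸ ha)
  exact ⟨k, by rw [← ratCast_re_of_star_eq_self h, hk, Rat.cast_intCast]⟩

theorem twist_icosianOf_intCast (a b c d : ℤ) :
    twist (icosianOf (a - b - d) (2 * d - c) (b + d * (tau - 1)) (d * (1 - 2 * tau))) =
      icosianOf (a - b - d) (2 * d - c) (b + d * (tau - 1)) (d * (1 - 2 * tau)) := by
  rw [twist_icosianOf, icosianOf_inj]
  simp only [star_sub, star_add, star_mul', star_intCast, star_tau, star_ofNat, star_one]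
  refine ⟨trivial, trivial, ?_, ?_⟩ <;> ring

/-- The element of the lattice `L` with the given coordinates in the basis that defines
`latticeL`, with values in `ℍ(K)`. -/
noncomputable def latticeVector (a b c d : ℤ) : TwistInvariant :=
  ⟨icosianOf (a - b - d) (2 * d - c) (b + d * (tau - 1)) (d * (1 - 2 * tau)),
    twist_icosianOf_intCast a b c d⟩

theorem toQuaternion_latticeVector (a b c d : ℤ) : toQuaternion (latticeVector a b c d) =
    icosianOf (a - b - d) (2 * d - c) (b + d * (tau - 1)) (d * (1 - 2 * tau)) := rfl

theorem realEmbedding_latticeVector (a b c d : ℤ) : realEmbedding (latticeVector a b c d) =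
    a • (⟨1, 0, 0, 0⟩ : ℍ[ℝ]) + b • (⟨-1 / 2, 1 / 2, 1 / 2, 1 / 2⟩ : ℍ[ℝ]) +
      c • (⟨0, -1, 0, 0⟩ : ℍ[ℝ]) +
      d • (⟨0, 1 / 2, (Real.goldenRatio - 1) / 2, -Real.goldenRatio / 2⟩ : ℍ[ℝ]) := by
  have hφ := Real.goldenRatio_sq
  have h2 : toReal 2 = 2 := map_ofNat toReal 2
  rw [realEmbedding_apply, toQuaternion_latticeVector]
  apply Quaternion.ext <;> simp [toReal_tau, h2] <;> grind

theorem mem_invariantIcosians_iff_exists_latticeVector {x : TwistInvariant} :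
    x ∈ invariantIcosians ↔ ∃ a b c d : ℤ, latticeVector a b c d = x := by
  rw [mem_invariantIcosians]
  constructor
  · intro hx
    have htx := twist_toQuaternion x
    obtain ⟨⟨a, ha⟩, ⟨b, hb⟩, ⟨c, s, t, rfl⟩, ⟨d, hd⟩, hq⟩ := mem_icosians_iff.1 hx
    rw [← hq, twist_icosianOf, icosianOf_inj, star_add_int_mul_tau] at htx
    obtain ⟨ha', hb', hc', hd'⟩ := htx
    obtain ⟨m, rfl⟩ := eq_intCast_of_star_eq_self ha ha'
    obtain ⟨n, rfl⟩ := eq_intCast_of_star_eq_self hb hb'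
    refine ⟨m + s + 2 * t, s + t, 2 * t - n, t, toQuaternion_injective ?_⟩
    rw [toQuaternion_latticeVector, ← hq, icosianOf_inj]
    push_cast at hc' ⊢
    refine ⟨by ring, by ring, by ring, by linear_combination hc' + hd'⟩
  · rintro ⟨a, b, c, d, rfl⟩
    have hI (k : ℤ) : (k : GoldenField) ∈ integers := intCast_mem _ k
    have h2 : (2 : GoldenField) ∈ integers := ofNat_mem _ 2
    rw [toQuaternion_latticeVector, icosianOf_mem_icosians_iff]
    exact ⟨sub_mem (sub_mem (hI a) (hI b)) (hI d), sub_mem (mul_mem h2 (hI d)) (hI c),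
      add_mem (hI b) (mul_mem (hI d) (sub_mem tau_mem_integers (one_mem _))),
      mul_mem (hI d) (sub_mem (one_mem _) (mul_mem h2 tau_mem_integers))⟩

theorem latticeL_eq_map : latticeL = invariantIcosians.map realEmbedding := by
  ext v
  refine mem_span_four.trans ⟨?_, ?_⟩
  · rintro ⟨a, b, c, d, rfl⟩
    exact ⟨latticeVector a b c d,
      mem_invariantIcosians_iff_exists_latticeVector.2 ⟨a, b, c, d, rfl⟩,
      realEmbedding_latticeVector a b c d⟩
  · rintro ⟨_, hx, rfl⟩
    obtain ⟨a, b, c, d, rfl⟩ := mem_invariantIcosians_iff_exists_latticeVector.1 hx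
    exact ⟨a, b, c, d, (realEmbedding_latticeVector a b c d).symm⟩

/-! ### The coincidence site lattice -/

theorem icosianRotation_realEmbedding {p : ℍ[GoldenField]} {n : ℕ} (h : twistLength p = n)
    (x : TwistInvariant) :
    icosianRotation p (realEmbedding x) = realEmbedding (twistConj p n x) := by
  rw [realEmbedding_apply, realEmbedding_apply, toQuaternion_twistConj, quatToReal_smul,
    quatToReal_mul, quatToReal_mul, map_inv₀, map_natCast, mul_assoc, icosianRotation, h, one_div]
  rfl

theorem twistConj_star_twistConj {p : ℍ[GoldenField]} {n : ℕ} (hn : 0 < n)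
    (h : Quaternion.normSq p * star (Quaternion.normSq p) = (n : GoldenField) ^ 2)
    (x : TwistInvariant) : twistConj (star p) n (twistConj p n x) = x := by
  have hn0 : (n : GoldenField) ≠ 0 := by exact_mod_cast hn.ne'
  have hassoc : star p * (p * x * twist p) * twist (star p) =
      star p * p * x * (twist p * star (twist p)) := by
    rw [twist_star]
    simp only [mul_assoc]
  apply toQuaternion_injective
  rw [toQuaternion_twistConj, toQuaternion_twistConj, mul_smul_quaternion, smul_mul_quaternion,
    hassoc, Quaternion.star_mul_self, Quaternion.self_mul_star, normSq_twist,
    Quaternion.coe_mul_eq_smul, Quaternion.mul_coe_eq_smul, smul_smul, smul_smul, smul_smul]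
  have hunit : (n : GoldenField)⁻¹ * ((n : GoldenField)⁻¹ * (star (Quaternion.normSq p) *
      Quaternion.normSq p)) = 1 := by
    rw [mul_comm (star _), h]
    field_simp
  simp only [mul_assoc, hunit, one_smul]

theorem map_twistConj {p : ℍ[GoldenField]} {n : ℕ} (hn : 0 < n)
    (h : Quaternion.normSq p * star (Quaternion.normSq p) = (n : GoldenField) ^ 2)
    (M : Submodule ℤ TwistInvariant) : M.map (twistConj p n) = M.comap (twistConj (star p) n) := by
  have hstar := twistConj_star_twistConj (p := star p) hn (by rwa [Quaternion.normSq_star])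
  rw [star_star] at hstar
  exact le_antisymm
    (Submodule.map_le_iff_le_comap.2 fun x hx => by
      rwa [Submodule.mem_comap, Submodule.mem_comap, twistConj_star_twistConj hn h])
    fun x hx => ⟨_, hx, hstar x⟩

theorem icosianCSL_eq_map {p : ℍ[GoldenField]} {n : ℕ} (hn : 0 < n) (h : twistLength p = n) :
    icosianCSL p = (coincidenceLattice p n).map realEmbedding := by
  have hcomm : (icosianRotation p).restrictScalars ℤ ∘ₗ realEmbedding =
      realEmbedding ∘ₗ twistConj p n := LinearMap.ext (icosianRotation_realEmbedding h)
  rw [icosianCSL, latticeL_eq_map, ← Submodule.map_comp, hcomm, Submodule.map_comp,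
    ← Submodule.map_inf _ realEmbedding_injective,
    map_twistConj hn (normSq_mul_star_of_twistLength h), coincidenceLattice]

theorem icosianCSL_eq_icosianCSL_iff {p q : ℍ[GoldenField]} {m n : ℕ} (hm : 0 < m) (hn : 0 < n)
    (hp : twistLength p = m) (hq : twistLength q = n) :
    icosianCSL p = icosianCSL q ↔ coincidenceLattice p m = coincidenceLattice q n := by
  rw [icosianCSL_eq_map hm hp, icosianCSL_eq_map hn hq,
    (Submodule.map_injective_of_injective realEmbedding_injective).eq_iff]

theorem coincidenceLattice_eq_iff {p q : ℍ[GoldenField]} (hp : IsPrimitiveIcosian p)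
    (hq : IsPrimitiveIcosian q) {n : ℕ} (hn : 0 < n)
    (h₁ : Quaternion.normSq p * star (Quaternion.normSq p) = (n : GoldenField) ^ 2)
    (h₂ : Quaternion.normSq q * star (Quaternion.normSq q) = (n : GoldenField) ^ 2) :
    coincidenceLattice p n = coincidenceLattice q n ↔
      p ∈ rightIdeal q (n / fiveDivisor n) ∧ q ∈ rightIdeal p (n / fiveDivisor n) :=
  ⟨fun h => ⟨hp.mem_rightIdeal_of_coincidenceLattice_le hq.1 hn h₂ h.ge,
    hq.mem_rightIdeal_of_coincidenceLattice_le hp.1 hn h₁ h.le⟩,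
  fun ⟨hpq, hqp⟩ => le_antisymm (coincidenceLattice_le_of_mem_rightIdeal hp.1 hn h₁ h₂ hqp)
    (coincidenceLattice_le_of_mem_rightIdeal hq.1 hn h₂ h₁ hpq)⟩

theorem eq_of_coincidenceLattice_eq {p q : ℍ[GoldenField]} (hp : IsPrimitiveIcosian p)
    (hq : IsPrimitiveIcosian q) {m n : ℕ} (hm : 0 < m) (hn : 0 < n)
    (h₁ : Quaternion.normSq p * star (Quaternion.normSq p) = (m : GoldenField) ^ 2)
    (h₂ : Quaternion.normSq q * star (Quaternion.normSq q) = (n : GoldenField) ^ 2)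
    (h : coincidenceLattice p m = coincidenceLattice q n) : m = n :=
  Nat.dvd_antisymm
    (hp.dvd_of_smul_mem_rightIdeal hq.1 hm
      (hp.smul_mem_rightIdeal_of_coincidenceLattice_le hq.1 hn h₂ h.ge))
    (hq.dvd_of_smul_mem_rightIdeal hp.1 hn
      (hq.smul_mem_rightIdeal_of_coincidenceLattice_le hp.1 hm h₁ h.le))

/-- The icosians `p₁`, `p₂` are primitive and admissible, `nᵢ` being the natural number `|pᵢ p̃ᵢ|`.
Norms are compared up to units of `𝔬`. Greatest left common divisors are determined up to right
multiplication by units of `𝕀`, so two of them "are equal" when they have a common value `g`. -/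
theorem theorem3 (p₁ p₂ : ℍ[GoldenField])
    (hp₁ : IsPrimitiveIcosian p₁) (hp₂ : IsPrimitiveIcosian p₂)
    (n₁ n₂ : ℕ) (hn₁ : twistLength p₁ = n₁) (hn₂ : twistLength p₂ = n₂) :
    icosianCSL p₁ = icosianCSL p₂ ↔
      (∃ ε : GoldenField.integersˣ,
          Quaternion.normSq p₁ = ((ε : GoldenField.integers) : GoldenField) *
            Quaternion.normSq p₂) ∧
        ∃ g : ℍ[GoldenField],
          IsIcosianGLCD g p₁ (((n₁ : GoldenField) / fiveCorrection p₁ : GoldenField)) ∧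
          IsIcosianGLCD g p₂ (((n₂ : GoldenField) / fiveCorrection p₂ : GoldenField)) := by
  have pos₁ := hp₁.twistLength_pos hn₁
  have pos₂ := hp₂.twistLength_pos hn₂
  have norm₁ := normSq_mul_star_of_twistLength hn₁
  have norm₂ := normSq_mul_star_of_twistLength hn₂
  rw [icosianCSL_eq_icosianCSL_iff pos₁ pos₂ hn₁ hn₂, fiveCorrection_eq_fiveDivisor hp₁.1 norm₁,
    fiveCorrection_eq_fiveDivisor hp₂.1 norm₂]
  have hglcd := exists_isIcosianGLCD_iff hp₁.1 hp₂.1 (natCast_div_fiveDivisor_mem_integers n₁)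
  constructor
  · intro h
    obtain rfl := eq_of_coincidenceLattice_eq hp₁ hp₂ pos₁ pos₂ norm₁ norm₂ h
    obtain ⟨h₁, h₂⟩ := (coincidenceLattice_eq_iff hp₁ hp₂ pos₁ norm₁ norm₂).1 h
    exact ⟨exists_unit_of_mem_rightIdeal hp₁.1 hp₂.1 pos₁ norm₁ norm₂ h₁ h₂, hglcd.2 ⟨h₁, h₂⟩⟩
  · rintro ⟨⟨ε, hε⟩, hg⟩
    obtain rfl := eq_of_eq_unit_mul ε hε norm₁ norm₂
    exact (coincidenceLattice_eq_iff hp₁ hp₂ pos₁ norm₁ norm₂).2 (hglcd.1 hg)
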